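/- \textbf{Setting.} Let $n,d\ge 1$, let $X\in\mathbb R^{n\times d}$ be a random matrix with rows $x_1,\dots,x_n\in\mathbb R^d$, let $\sigma_d>0$, $q\in[0,1]$, and let $\mu$ be a probability measure on $\mathbb R$. Put $\pi_0=(1-q)\delta_0+q\mu$. For $\gamma>\sigma_d^{-2}\|X\|_{\rm op}^2$ and $y\in\mathbb R^n$ let $A=\gamma I_d-\sigma_d^{-2}X^{\top}X$, $h=\sigma_d^{-2}X^{\top}y$, $$V_\gamma(x)=-\log\int_{\mathbb R}e^{x\theta-\frac{\gamma}{2}\theta^2}\,\pi_0(d\theta),\qquad H(\varphi)=\tfrac12\langle\varphi,A^{-1}\varphi\rangle+\sum_{i=1}^dV_\gamma(h_i+\varphi_i)\quad(\varphi\in\mathbb R^d).$$ The sub-Gaussian norm of a real random variable $Y$ is $\|Y\|_{\psi_2}=\inf\{t>0:\mathbb E\,e^{Y^2/t^2}\le 2\}$, and that of a random vector $Y$ is $\sup_{\|u\|=1}\|\langle Y,u\rangle\|_{\psi_2}$. \textbf{Theorem.} Fix constants $c_1,c_2>0$. For every $q\in[0,1]$ and every probability measure $\mu$ on $\mathbb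 R$ there is a constant $C_1>0$, depending only on $(q,\mu)$ (and on the fixed constants $c_1,c_2$), such that the following holds. Assume that: (1) $x_1,\dots,x_n$ are independent; (2) $\mathbb E[x_ix_i^{\top}]=I_d$ for all $i$; (3) $\|x_i\|_{\psi_2}\le K<\infty$ for all $i$; (4) $c_1>\sigma_d^2/d>c_2$; (5) $\mu$ has a log-concave density $f_\mu$ that is symmetric about the origin, and there are $a,b>0$ and an integer $k\ge1$ with $f_\mu(x)\ge a\,e^{-bx^{2k}}$ for all $x\in\mathbb R$. If $$\frac nd\ge 4C_1K^4,\qquad \frac{\sqrt{d/n}}{2K^2}\ge C_1\Big(\frac dn+\frac{d^2}{n^2}\Big)\Big(1+\log\Big(\frac nd+1\Big)\Big)^{\frac{2k-1}{k}},$$ then with probability at least $1-2e^{-d}$ the sampling problem is feasible: there is $\gamma>\sigma_d^{-2}\|X\|_{\rm op}^2$ such that $V_\gamma$ is twice continuously differentiable with $\inf V_\gamma''$ finite, $$\frac{1}{\gamma-\lambda_{\min}(\sigma_d^{-2}X^{\top}X)}+\inf_{x\in\mathbb R}V_\gamma''(x)>0,$$ and $H$ is strongly convex on $\mathbb R^d$,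 with a modulus of strong convexity that does not depend on $y$. -/

import Mathlib

open MeasureTheory ProbabilityTheory Set
open scoped ENNReal Matrix

noncomputable section

/-- The sub-Gaussian norm `inf {t > 0 : E exp(Y² / t²) ≤ 2}` of a real random variable `Y`
(equal to `∞` if there is no such `t`). -/
def psi2Norm {Ω : Type*} [MeasurableSpace Ω] (P : Measure Ω) (Y : Ω → ℝ) : ℝ≥0∞ :=
  ⨅ (t : ℝ) (_ : 0 < t) (_ : ∫⁻ ω, ENNReal.ofReal (Real.exp (Y ω ^ 2 / t ^ 2)) ∂P ≤ 2),
    ENNReal.ofReal t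

/-- The sub-Gaussian norm of a random vector: the supremum over unit vectors `u` of the
sub-Gaussian norms of the marginals `⟨Y, u⟩`. -/
def psi2NormVec {Ω : Type*} [MeasurableSpace Ω] (P : Measure Ω) {d : ℕ}
    (Y : Ω → EuclideanSpace ℝ (Fin d)) : ℝ≥0∞ :=
  ⨆ (u : EuclideanSpace ℝ (Fin d)) (_ : ‖u‖ = 1), psi2Norm P (fun ω => inner ℝ (Y ω) u)

/-- `E[Y Yᵀ] = I`. -/
def IsIsotropic {Ω : Type*} [MeasurableSpace Ω] (P : Measure Ω) {d : ℕ}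
    (Y : Ω → EuclideanSpace ℝ (Fin d)) : Prop :=
  ∀ j l : Fin d, Integrable (fun ω => Y ω j * Y ω l) P ∧
    ∫ ω, Y ω j * Y ω l ∂P = (1 : Matrix (Fin d) (Fin d) ℝ) j l

/-- The measure `μ` on the line has a density `f` which is log-concave, symmetric about the
origin, and bounded below by `a * exp (-b * x ^ (2k))` for some `a, b > 0`. Since the last
property makes `f` positive, log-concavity is concavity of `log f`. -/
def IsAdmissibleSlab (μ : Measure ℝ) (k : ℕ) : Prop :=
  ∃ f : ℝ → ℝ,
    μ = (volume : Measure ℝ).withDensity (fun x => ENNReal.ofReal (f x)) ∧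
    ConcaveOn ℝ univ (fun x => Real.log (f x)) ∧
    (∀ x, f (-x) = f x) ∧
    ∃ a > 0, ∃ b > 0, ∀ x, a * Real.exp (-b * x ^ (2 * k)) ≤ f x

/-- The spike-and-slab prior `(1 - q) δ₀ + q μ`. -/
def spikeSlab (q : ℝ) (μ : Measure ℝ) : Measure ℝ :=
  ENNReal.ofReal (1 - q) • Measure.dirac 0 + ENNReal.ofReal q • μ

/-- `V_γ(x) = -log ∫ exp(x θ - γ θ² / 2) π₀(dθ)`. -/
def potentialV (π₀ : Measure ℝ) (γ : ℝ) (x : ℝ) : ℝ :=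
  -Real.log (∫ θ, Real.exp (x * θ - γ / 2 * θ ^ 2) ∂π₀)

/-- The operator norm of a matrix acting between Euclidean spaces. -/
def matrixOpNorm {n d : ℕ} (X : Matrix (Fin n) (Fin d) ℝ) : ℝ :=
  ‖(Matrix.toEuclideanLin X).toContinuousLinearMap‖

/-- The minimum eigenvalue of a real symmetric matrix. -/
def lambdaMin {d : ℕ} (M : Matrix (Fin d) (Fin d) ℝ) : ℝ :=
  sInf (spectrum ℝ M)

/-- `A = γ I - σ⁻² Xᵀ X`. -/
def couplingMatrix {n d : ℕ} (σ γ : ℝ) (X : Matrix (Fin n) (Fin d) ℝ) :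
    Matrix (Fin d) (Fin d) ℝ :=
  γ • (1 : Matrix (Fin d) (Fin d) ℝ) - (σ ^ 2)⁻¹ • (Xᵀ * X)

/-- `H(φ) = ⟨φ, A⁻¹ φ⟩ / 2 + ∑ᵢ V_γ(hᵢ + φᵢ)` with `h = σ⁻² Xᵀ y`. -/
def hamiltonian {n d : ℕ} (π₀ : Measure ℝ) (σ γ : ℝ) (X : Matrix (Fin n) (Fin d) ℝ)
    (y : Fin n → ℝ) (φ : EuclideanSpace ℝ (Fin d)) : ℝ :=
  1 / 2 * (φ.ofLp ⬝ᵥ ((couplingMatrix σ γ X)⁻¹ *ᵥ φ.ofLp)) +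
    ∑ i, potentialV π₀ γ (((σ ^ 2)⁻¹ • (Xᵀ *ᵥ y)) i + φ i)

/-- The criterion `1 / (γ - λ_min(σ⁻² Xᵀ X)) + inf V_γ'' > 0`, where `V_γ` is twice continuously
differentiable and the infimum is a genuine (finite) one. -/
def FeasibilityCriterion {n d : ℕ} (π₀ : Measure ℝ) (σ γ : ℝ)
    (X : Matrix (Fin n) (Fin d) ℝ) : Prop :=
  ContDiff ℝ 2 (potentialV π₀ γ) ∧
    BddBelow (range (iteratedDeriv 2 (potentialV π₀ γ))) ∧
    0 < 1 / (γ - lambdaMin ((σ ^ 2)⁻¹ • (Xᵀ * X))) +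
      ⨅ x : ℝ, iteratedDeriv 2 (potentialV π₀ γ) x

/-- The sampling problem is feasible: for some `γ > σ⁻² ‖X‖²` the criterion holds and `H` is
strongly convex, with a modulus that does not depend on the response `y`. -/
def IsFeasible {n d : ℕ} (π₀ : Measure ℝ) (σ : ℝ) (X : Matrix (Fin n) (Fin d) ℝ) : Prop :=
  ∃ γ : ℝ, (σ ^ 2)⁻¹ * matrixOpNorm X ^ 2 < γ ∧ FeasibilityCriterion π₀ σ γ X ∧
    ∃ m > 0, ∀ y : Fin n → ℝ, StrongConvexOn univ m (hamiltonian π₀ σ γ X y)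

end

/-! Write `s = √(d/n)`, `N = n/σ²`, `ε = 2944 K² s`, and take `γ = N(1 + 2ε)`. Strong convexity is a
contest between the smallest eigenvalue of `A⁻¹` and the worst concavity of `V_γ`.

Design side (`exists_event_abs_form_le`): Bernstein's inequality on a net puts the spectrum of
`σ⁻²XᵀX` in `[N(1-ε), N(1+ε)]` outside an event of probability `2e^{-d}`. Then `A` is positive
definite and at most `3εN`, so `A⁻¹ ≥ 1/(3εN)`, which is of order `s/K²`.

Prior side (`exists_curvature_bound`): `V_γ''` is minus the variance of the tilted prior, and this
variance is `O((1 + log(γ+1))/γ)` uniformly in the tilt. It is bounded by the second moment about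
the mode `c` of the tilted slab. The slab contributes at most `8/γ` times its mass, since
log-concavity contracts it towards `c`. The spike contributes `(1-q)c²` with `|c| ≤ |x|/γ`; when
this is not already of order `log γ/γ`, the slab has so much tilted mass that it pays for the spike.

As `γ` is of order `s⁻²`, the concavity is at most of order `s²` times a logarithm, and the second
hypothesis on `n/d` makes this smaller than `s/K²`. -/

/-! ### Nets and quadratic forms on the sphere -/

/-- The unit sphere of `ℝ^d` has a `1/2`-net of cardinality at most `5 ^ d`. -/
theorem exists_half_net (d : ℕ) : ∃ N : Finset (EuclideanSpace ℝ (Fin d)),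
    (∀ u ∈ N, ‖u‖ = 1) ∧ N.card ≤ 5 ^ d ∧ ∀ v, ‖v‖ = 1 → ∃ u ∈ N, ‖u - v‖ ≤ 1 / 2 := by
  classical
  let sep : Finset (EuclideanSpace ℝ (Fin d)) → Prop := fun s =>
    (∀ u ∈ s, ‖u‖ = 1) ∧ ∀ u ∈ s, ∀ v ∈ s, u ≠ v → 1 / 2 ≤ ‖u - v‖
  have hcard : ∀ s, sep s → s.card ≤ 5 ^ d := by
    intro s hs
    -- Doubling gives a 1-separated set in the ball of radius 2, the normalisation of the packing
    -- bound `5 ^ d`.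
    have hinj : Function.Injective fun u : EuclideanSpace ℝ (Fin d) => (2 : ℝ) • u :=
      smul_right_injective _ two_ne_zero
    have h := Besicovitch.card_le_of_separated (s.image fun u => (2 : ℝ) • u) ?_ ?_
    · rwa [Finset.card_image_of_injective _ hinj, finrank_euclideanSpace_fin] at h
    · intro c hc
      obtain ⟨u, hu, rfl⟩ := Finset.mem_image.1 hc
      simp [norm_smul, hs.1 u hu]
    · intro c hc e he hne
      obtain ⟨u, hu, rfl⟩ := Finset.mem_image.1 hc
      obtain ⟨v, hv, rfl⟩ := Finset.mem_image.1 he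
      have := hs.2 u hu v hv (fun h => hne (by rw [h]))
      rw [← smul_sub, norm_smul]
      norm_num
      linarith
  have hne : {m | ∃ s, sep s ∧ s.card = m}.Nonempty := ⟨0, ∅, by simp [sep], rfl⟩
  have hbdd : BddAbove {m | ∃ s, sep s ∧ s.card = m} :=
    ⟨5 ^ d, by rintro m ⟨s, hs, rfl⟩; exact hcard s hs⟩
  -- A separated set of maximal cardinality is a net: a vector farther than `1/2` from it could be
  -- added.
  obtain ⟨N, hN, hNc⟩ := Nat.sSup_mem hne hbdd
  refine ⟨N, hN.1, hcard N hN, fun v hv => ?_⟩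
  by_contra! hfar
  have hvN : v ∉ N := fun h => by have := hfar v h; norm_num at this
  have hins : sep (insert v N) := by
    constructor
    · intro u hu
      rcases Finset.mem_insert.1 hu with rfl | hu
      exacts [hv, hN.1 u hu]
    · intro u hu w hw huw
      rcases Finset.mem_insert.1 hu with hu' | hu' <;>
        rcases Finset.mem_insert.1 hw with hw' | hw'
      · exact absurd (hu'.trans hw'.symm) huw
      · rw [norm_sub_rev, hu']; exact (hfar w hw').le
      · rw [hw']; exact (hfar u hu').le
      · exact hN.2 u hu' w hw' huw
  have := le_csSup hbdd ⟨_, hins, rfl⟩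
  rw [Finset.card_insert_of_notMem hvN, ← hNc] at this
  omega

/-- A quadratic form `a ‖L v‖² - ‖v‖²` that is bounded by `δ` on a `1/2`-net of the unit sphere is
bounded by `32 δ` on the unit sphere. -/
theorem abs_form_le_of_net {d : ℕ} {F : Type*} [NormedAddCommGroup F] [InnerProductSpace ℝ F]
    (L : EuclideanSpace ℝ (Fin d) →L[ℝ] F) (a δ : ℝ) (N : Finset (EuclideanSpace ℝ (Fin d)))
    (hN1 : ∀ u ∈ N, ‖u‖ = 1) (hN : ∀ v, ‖v‖ = 1 → ∃ u ∈ N, ‖u - v‖ ≤ 1 / 2)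
    (hδ : ∀ u ∈ N, |a * ‖L u‖ ^ 2 - ‖u‖ ^ 2| ≤ δ) (v : EuclideanSpace ℝ (Fin d)) :
    |a * ‖L v‖ ^ 2 - ‖v‖ ^ 2| ≤ 32 * δ * ‖v‖ ^ 2 := by
  set Q : EuclideanSpace ℝ (Fin d) → ℝ := fun v => a * ‖L v‖ ^ 2 - ‖v‖ ^ 2 with hQ
  have hQs : ∀ (c : ℝ) v, Q (c • v) = c ^ 2 * Q v := fun c v => by
    simp only [hQ, map_smul, norm_smul, mul_pow, Real.norm_eq_abs, sq_abs]; ring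
  -- Polarization `4 B(p, r) = Q(p + r) - Q(p - r)` with `p = 2(u - v)` and `r = (u + v)/2`; the
  -- weights balance the small vector `u - v` against `u + v`.
  have hpol : ∀ u v, 4 * (Q u - Q v) = Q ((5 / 2 : ℝ) • u - (3 / 2 : ℝ) • v)
      - Q ((3 / 2 : ℝ) • u - (5 / 2 : ℝ) • v) := by
    intro u v
    simp only [hQ, map_smul, map_sub, norm_sub_sq_real, norm_smul, inner_smul_left,
      inner_smul_right, mul_pow, Real.norm_eq_abs, sq_abs, conj_trivial]
    ring
  by_cases hv0 : v = 0
  · simp [hv0]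
  have hnorm : ∀ w : EuclideanSpace ℝ (Fin d), w ≠ 0 → ‖‖w‖⁻¹ • w‖ = 1 := fun w hw => by
    rw [norm_smul, norm_inv, norm_norm, inv_mul_cancel₀ (norm_ne_zero_iff.2 hw)]
  obtain ⟨w, hw, hmax⟩ := (isCompact_sphere (0 : EuclideanSpace ℝ (Fin d)) 1).exists_isMaxOn
    ⟨‖v‖⁻¹ • v, by simpa using hnorm v hv0⟩ (f := fun v => |Q v|) (by fun_prop)
  rw [mem_sphere_zero_iff_norm] at hw
  have hS : ∀ z, |Q z| ≤ |Q w| * ‖z‖ ^ 2 := by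
    intro z
    by_cases hz : z = 0
    · simp [hz, hQ]
    have h1 : |Q (‖z‖⁻¹ • z)| ≤ |Q w| := hmax (by simpa using hnorm z hz)
    have h2 := hQs ‖z‖ (‖z‖⁻¹ • z)
    rw [smul_inv_smul₀ (norm_ne_zero_iff.2 hz)] at h2
    rw [h2, abs_mul, abs_of_nonneg (sq_nonneg _), mul_comm]
    gcongr
  obtain ⟨u, hu, huw⟩ := hN w hw
  have hu1 := hN1 u hu
  have h1 := hS ((5 / 2 : ℝ) • u - (3 / 2 : ℝ) • w)
  have h2 := hS ((3 / 2 : ℝ) • u - (5 / 2 : ℝ) • w)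
  have h3 : ‖(5 / 2 : ℝ) • u - (3 / 2 : ℝ) • w‖ ^ 2 + ‖(3 / 2 : ℝ) • u - (5 / 2 : ℝ) • w‖ ^ 2
      = 2 + 15 / 2 * ‖u - w‖ ^ 2 := by
    simp only [norm_sub_sq_real, norm_smul, inner_smul_left, inner_smul_right, mul_pow,
      Real.norm_eq_abs, sq_abs, conj_trivial, hu1, hw]
    ring
  have h4 : ‖u - w‖ ^ 2 ≤ 1 / 4 := by nlinarith [norm_nonneg (u - w)]
  have h5 : |Q w| ≤ δ + |Q u - Q w| := by
    have := hδ u hu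
    have h6 : |Q w| ≤ |Q u| + |Q u - Q w| := by
      have := abs_sub (Q u) (Q u - Q w); simpa using this
    linarith
  have h6 : 4 * |Q u - Q w| ≤ |Q w| * (2 + 15 / 2 * ‖u - w‖ ^ 2) := by
    rw [← h3, mul_add, show 4 * |Q u - Q w| = |4 * (Q u - Q w)| by rw [abs_mul]; norm_num, hpol]
    exact (abs_sub _ _).trans (add_le_add h1 h2)
  -- The maximum satisfies `|Q w| ≤ δ + (31/32)|Q w|`, whence the factor 32.
  have h7 : |Q w| * (2 + 15 / 2 * ‖u - w‖ ^ 2) ≤ |Q w| * (31 / 8) := by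
    gcongr; linarith
  have h8 : |Q w| ≤ 32 * δ := by linarith
  exact (hS v).trans (by gcongr)

/-! ### Bernstein's inequality -/

theorem Real.exp_le_one_add_add_sq_mul_exp_abs (z : ℝ) :
    Real.exp z ≤ 1 + z + z ^ 2 * Real.exp |z| := by
  have h := Complex.norm_exp_sub_sum_le_norm_mul_exp (z : ℂ) 2
  have h2 : Complex.exp z - ∑ m ∈ Finset.range 2, (z : ℂ) ^ m / m.factorial
      = ((Real.exp z - (1 + z) : ℝ) : ℂ) := by
    simp [Finset.sum_range_succ]
  rw [h2, Complex.norm_real, Complex.norm_real, Real.norm_eq_abs, Real.norm_eq_abs, sq_abs] at h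
  linarith [le_abs_self (Real.exp z - (1 + z))]

/-- The quadratic remainder is absorbed into `exp (s / T)`, whose mean is controlled. With `w = (s +
1)/T`, use `|l (s - 1)| ≤ w/2`, `w² ≤ 8 exp (w/2)` and `e < 11/4`; then `22 = 8 · 11/4`. -/
theorem exp_mul_sub_one_le {T l s : ℝ} (hT : 1 ≤ T) (hl : |l| ≤ 1 / (2 * T)) (hs : 0 ≤ s) :
    Real.exp (l * (s - 1)) ≤ 1 + l * (s - 1) + 22 * (l ^ 2 * T ^ 2) * Real.exp (s / T) := by
  have hT0 : 0 < T := by linarith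
  set w := (s + 1) / T with hw
  have hw0 : 0 ≤ w := by positivity
  have habs : |l * (s - 1)| ≤ w / 2 := by
    rw [abs_mul]
    calc |l| * |s - 1| ≤ 1 / (2 * T) * (s + 1) := by
          gcongr
          rw [abs_le]; constructor <;> linarith
      _ = w / 2 := by rw [hw]; field_simp
  have hsq : (l * (s - 1)) ^ 2 ≤ l ^ 2 * T ^ 2 * w ^ 2 := by
    have : l ^ 2 * T ^ 2 * w ^ 2 = l ^ 2 * (s + 1) ^ 2 := by rw [hw]; field_simp
    rw [this, mul_pow]
    gcongr 1
    nlinarith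
  have hwexp : w ^ 2 ≤ 8 * Real.exp (w / 2) := by
    have := Real.quadratic_le_exp_of_nonneg (x := w / 2) (by positivity)
    nlinarith
  have hwle : Real.exp w ≤ Real.exp (s / T) * (11 / 4) := by
    have h1 : w ≤ s / T + 1 := by
      rw [hw, add_div]; gcongr; rw [div_le_one hT0]; exact hT
    calc Real.exp w ≤ Real.exp (s / T + 1) := Real.exp_le_exp.2 h1
      _ = Real.exp (s / T) * Real.exp 1 := Real.exp_add _ _
      _ ≤ _ := by gcongr; linarith [Real.exp_one_lt_d9]
  calc Real.exp (l * (s - 1))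
      ≤ 1 + l * (s - 1) + (l * (s - 1)) ^ 2 * Real.exp |l * (s - 1)| :=
        Real.exp_le_one_add_add_sq_mul_exp_abs _
    _ ≤ 1 + l * (s - 1) + (l ^ 2 * T ^ 2 * (8 * Real.exp (w / 2))) * Real.exp (w / 2) := by
        gcongr
        exact hsq.trans (by gcongr)
    _ = 1 + l * (s - 1) + (l ^ 2 * T ^ 2) * 8 * Real.exp w := by
        rw [show w = w / 2 + w / 2 by ring, Real.exp_add, ← two_mul]; ring_nf
    _ ≤ 1 + l * (s - 1) + (l ^ 2 * T ^ 2) * 8 * (Real.exp (s / T) * (11 / 4)) := by gcongr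
    _ = _ := by ring

section Bernstein

variable {Ω : Type*} [MeasurableSpace Ω] {P : Measure Ω}

theorem integrable_exp_div_and_integral_le {s : Ω → ℝ} {T : ℝ} (hm : Measurable s)
    (hexp : ∫⁻ ω, ENNReal.ofReal (Real.exp (s ω / T)) ∂P ≤ 2) :
    Integrable (fun ω => Real.exp (s ω / T)) P ∧ ∫ ω, Real.exp (s ω / T) ∂P ≤ 2 := by
  have hm' : Measurable fun ω => Real.exp (s ω / T) := by fun_prop
  have hint : Integrable (fun ω => Real.exp (s ω / T)) P := by
    refine ⟨hm'.aestronglyMeasurable, ?_⟩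
    rw [hasFiniteIntegral_iff_ofReal (ae_of_all _ fun ω => (Real.exp_pos _).le)]
    exact hexp.trans_lt (by simp)
  refine ⟨hint, ?_⟩
  rw [integral_eq_lintegral_of_nonneg_ae (ae_of_all _ fun ω => (Real.exp_pos _).le)
    hm'.aestronglyMeasurable]
  exact ENNReal.toReal_mono (by simp) hexp

variable [IsProbabilityMeasure P]

/-- The moment generating function of a centred subexponential variable. -/
theorem mgf_sub_one_le {s : Ω → ℝ} {T l : ℝ} (hm : Measurable s) (hs : ∀ ω, 0 ≤ s ω)
    (hT : 1 ≤ T) (hexp : ∫⁻ ω, ENNReal.ofReal (Real.exp (s ω / T)) ∂P ≤ 2)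
    (hsi : Integrable s P) (hmean : ∫ ω, s ω ∂P = 1) (hl : |l| ≤ 1 / (2 * T)) :
    Integrable (fun ω => Real.exp (l * (s ω - 1))) P ∧
      mgf (fun ω => s ω - 1) P l ≤ Real.exp (44 * (l ^ 2 * T ^ 2)) := by
  obtain ⟨hei, hele⟩ := integrable_exp_div_and_integral_le hm hexp
  have hsub : Integrable (fun ω => s ω - 1) P := hsi.sub (integrable_const 1)
  have hlin : Integrable (fun ω => 1 + l * (s ω - 1)) P :=
    (integrable_const 1).add (hsub.const_mul l)
  have hdom : Integrable
      (fun ω => 1 + l * (s ω - 1) + 22 * (l ^ 2 * T ^ 2) * Real.exp (s ω / T)) P :=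
    hlin.add (hei.const_mul _)
  have hle := fun ω => exp_mul_sub_one_le hT hl (hs ω)
  have hint : Integrable (fun ω => Real.exp (l * (s ω - 1))) P := by
    refine hdom.mono' (by fun_prop) (ae_of_all _ fun ω => ?_)
    rw [Real.norm_eq_abs, Real.abs_exp]
    exact hle ω
  refine ⟨hint, ?_⟩
  calc mgf (fun ω => s ω - 1) P l
      ≤ ∫ ω, (1 + l * (s ω - 1) + 22 * (l ^ 2 * T ^ 2) * Real.exp (s ω / T)) ∂P :=
        integral_mono hint hdom hle
    _ = 1 + 22 * (l ^ 2 * T ^ 2) * ∫ ω, Real.exp (s ω / T) ∂P := by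
        rw [integral_add hlin (hei.const_mul _), integral_const_mul,
          integral_add (integrable_const 1) (hsub.const_mul l),
          integral_const_mul, integral_sub hsi (integrable_const 1), hmean]
        simp
    _ ≤ 1 + 22 * (l ^ 2 * T ^ 2) * 2 := by gcongr
    _ ≤ Real.exp (44 * (l ^ 2 * T ^ 2)) := by
        have := Real.add_one_le_exp (44 * (l ^ 2 * T ^ 2))
        linarith

/-- Bernstein's inequality for a sum of independent nonnegative subexponential variables of
mean `1`. -/
theorem measure_abs_sum_sub_one_ge_le {n : ℕ} {s : Fin n → Ω → ℝ} {T δ : ℝ}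
    (hm : ∀ i, Measurable (s i)) (hs : ∀ i ω, 0 ≤ s i ω) (hT : 1 ≤ T)
    (hexp : ∀ i, ∫⁻ ω, ENNReal.ofReal (Real.exp (s i ω / T)) ∂P ≤ 2)
    (hsi : ∀ i, Integrable (s i) P) (hmean : ∀ i, ∫ ω, s i ω ∂P = 1)
    (hind : iIndepFun s P) (hδ0 : 0 ≤ δ) (hδ : δ ≤ 44 * T) :
    P.real {ω | n * δ ≤ |∑ i, (s i ω - 1)|} ≤ 2 * Real.exp (-(n * δ ^ 2 / (176 * T ^ 2))) := by
  have hT0 : 0 < T := by linarith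
  set X : Fin n → Ω → ℝ := fun i ω => s i ω - 1 with hX
  have hXm : ∀ i, Measurable (X i) := fun i => (hm i).sub_const 1
  have hXind : iIndepFun X P := hind.comp (fun _ r => r - 1) fun _ => measurable_id.sub_const 1
  -- The minimiser of `-lδ + 44 l² T²`; the assumption `δ ≤ 44 T` keeps it in the admissible range.
  set l : ℝ := δ / (88 * T ^ 2) with hl
  have hl0 : 0 ≤ l := by positivity
  have hlT : l ≤ 1 / (2 * T) := by
    rw [hl, div_le_div_iff₀ (by positivity) (by positivity)]
    nlinarith
  have key : ∀ c : ℝ, |c| = l →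
      Integrable (fun ω => Real.exp (c * (∑ i, X i) ω)) P ∧
      mgf (∑ i, X i) P c ≤ Real.exp (n * (44 * (l ^ 2 * T ^ 2))) := by
    intro c hc
    have hi := fun i => mgf_sub_one_le (hm i) (hs i) hT (hexp i) (hsi i) (hmean i)
      (l := c) (by rw [hc]; exact hlT)
    refine ⟨hXind.integrable_exp_mul_sum hXm fun i _ => (hi i).1, ?_⟩
    rw [hXind.mgf_sum hXm]
    calc ∏ i, mgf (X i) P c ≤ ∏ _i : Fin n, Real.exp (44 * (l ^ 2 * T ^ 2)) := by
          refine Finset.prod_le_prod (fun i _ => mgf_nonneg) fun i _ => ?_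
          rw [← hc, sq_abs]
          exact (hi i).2
      _ = _ := by rw [Finset.prod_const, Finset.card_univ, Fintype.card_fin, Real.exp_nat_mul]
  have hval : -l * (n * δ) + n * (44 * (l ^ 2 * T ^ 2)) = -(n * δ ^ 2 / (176 * T ^ 2)) := by
    rw [hl]; field_simp; ring
  obtain ⟨hi1, hm1⟩ := key l (abs_of_nonneg hl0)
  obtain ⟨hi2, hm2⟩ := key (-l) (by rw [abs_neg, abs_of_nonneg hl0])
  have hup : P.real {ω | n * δ ≤ (∑ i, X i) ω} ≤ Real.exp (-(n * δ ^ 2 / (176 * T ^ 2))) := by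
    refine (measure_ge_le_exp_mul_mgf _ hl0 hi1).trans ?_
    rw [← hval, Real.exp_add]
    gcongr
  have hlo : P.real {ω | (∑ i, X i) ω ≤ -(n * δ)} ≤
      Real.exp (-(n * δ ^ 2 / (176 * T ^ 2))) := by
    refine (measure_le_le_exp_mul_mgf _ (by linarith : -l ≤ 0) hi2).trans ?_
    rw [← hval, Real.exp_add, neg_neg, mul_neg, ← neg_mul]
    gcongr
  calc P.real {ω | n * δ ≤ |∑ i, (s i ω - 1)|}
      ≤ P.real ({ω | n * δ ≤ (∑ i, X i) ω} ∪ {ω | (∑ i, X i) ω ≤ -(n * δ)}) := by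
        refine measureReal_mono fun ω hω => ?_
        simp only [mem_ofPred_eq, mem_union, Finset.sum_apply, hX] at hω ⊢
        rcases le_abs.1 hω with h | h
        · exact Or.inl h
        · right; linarith
    _ ≤ _ := (measureReal_union_le _ _).trans (by linarith)

end Bernstein

/-! ### Concentration of the empirical covariance -/

section Design

variable {Ω : Type*} [MeasurableSpace Ω] {P : Measure Ω}

theorem lintegral_exp_le_of_psi2Norm_le {Y : Ω → ℝ} {K t : ℝ}
    (hY : psi2Norm P Y ≤ ENNReal.ofReal K) (ht : 0 < t) (hKt : K < t) :
    ∫⁻ ω, ENNReal.ofReal (Real.exp (Y ω ^ 2 / t ^ 2)) ∂P ≤ 2 := by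
  have hlt : psi2Norm P Y < ENNReal.ofReal t :=
    hY.trans_lt ((ENNReal.ofReal_lt_ofReal_iff ht).2 hKt)
  simp only [psi2Norm, iInf_lt_iff] at hlt
  obtain ⟨r, hr, hint, hrt⟩ := hlt
  rw [ENNReal.ofReal_lt_ofReal_iff ht] at hrt
  refine (lintegral_mono fun ω => ?_).trans hint
  gcongr

/-- If `t < 1` were admissible, then `2 ≥ E exp(Y²/t²) ≥ 1 + 1/t² > 2`. -/
theorem one_le_of_psi2Norm_le [IsProbabilityMeasure P] {Y : Ω → ℝ} {K : ℝ} (hm : Measurable Y)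
    (hY : psi2Norm P Y ≤ ENNReal.ofReal K) (hi : Integrable (fun ω => Y ω ^ 2) P)
    (h1 : ∫ ω, Y ω ^ 2 ∂P = 1) : 1 ≤ K := by
  by_contra! hK
  set t := (max K 0 + 1) / 2 with ht
  have ht0 : 0 < t := by have := le_max_right K 0; linarith
  have hKt : K < t := by
    have := le_max_left K 0
    have : max K 0 < 1 := max_lt hK one_pos
    linarith
  have ht1 : t < 1 := by
    have : max K 0 < 1 := max_lt hK one_pos
    linarith
  obtain ⟨hei, hele⟩ := integrable_exp_div_and_integral_le (s := fun ω => Y ω ^ 2) (T := t ^ 2)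
    (by fun_prop) (lintegral_exp_le_of_psi2Norm_le hY ht0 hKt)
  have hle : ∫ ω, (Y ω ^ 2 / t ^ 2 + 1) ∂P ≤ 2 :=
    (integral_mono ((hi.div_const _).add (integrable_const 1)) hei
      fun ω => Real.add_one_le_exp _).trans hele
  rw [integral_add (hi.div_const _) (integrable_const 1), integral_div, h1] at hle
  have h2 : 1 < 1 / t ^ 2 := by
    rw [lt_div_iff₀ (by positivity)]; nlinarith
  simp at hle
  rw [one_div] at h2
  linarith

theorem IsIsotropic.inner_sq {d : ℕ} {Y : Ω → EuclideanSpace ℝ (Fin d)} (h : IsIsotropic P Y)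
    (u : EuclideanSpace ℝ (Fin d)) :
    Integrable (fun ω => inner ℝ (Y ω) u ^ 2) P ∧ ∫ ω, inner ℝ (Y ω) u ^ 2 ∂P = ‖u‖ ^ 2 := by
  have hexpand : (fun ω => inner ℝ (Y ω) u ^ 2)
      = fun ω => ∑ j, ∑ l, u j * u l * (Y ω j * Y ω l) := by
    funext ω
    rw [PiLp.inner_apply, sq, Finset.sum_mul_sum]
    refine Finset.sum_congr rfl fun j _ => Finset.sum_congr rfl fun l _ => ?_
    simp
    ring
  have hi : ∀ j l, Integrable (fun ω => u j * u l * (Y ω j * Y ω l)) P :=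
    fun j l => (h j l).1.const_mul _
  rw [hexpand]
  refine ⟨integrable_finsetSum _ fun j _ => integrable_finsetSum _ fun l _ => hi j l, ?_⟩
  rw [integral_finsetSum _ fun j _ => integrable_finsetSum _ fun l _ => hi j l,
    EuclideanSpace.norm_sq_eq]
  refine Finset.sum_congr rfl fun j _ => ?_
  rw [integral_finsetSum _ fun l _ => hi j l]
  simp only [integral_const_mul, (h j _).2]
  simp [Matrix.one_apply, sq]

theorem norm_sq_toEuclideanLin {n d : ℕ} (z : Fin n → EuclideanSpace ℝ (Fin d))
    (v : EuclideanSpace ℝ (Fin d)) :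
    ‖Matrix.toEuclideanLin (Matrix.of fun i j => z i j) v‖ ^ 2 = ∑ i, inner ℝ (z i) v ^ 2 := by
  rw [EuclideanSpace.norm_sq_eq]
  refine Finset.sum_congr rfl fun i _ => ?_
  rw [Real.norm_eq_abs, sq_abs, PiLp.inner_apply]
  congr 1
  simp [Matrix.toLpLin_apply, Matrix.mulVec, dotProduct, mul_comm]

/-- The empirical covariance of independent isotropic sub-Gaussian rows is close to the identity
with high probability. -/
theorem exists_event_abs_form_le [IsProbabilityMeasure P] {n d : ℕ} (hn : 1 ≤ n) (hd : 1 ≤ d)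
    {x : Fin n → Ω → EuclideanSpace ℝ (Fin d)} {K : ℝ} (hm : ∀ i, Measurable (x i))
    (hind : iIndepFun x P) (hiso : ∀ i, IsIsotropic P (x i))
    (hpsi : ∀ i, psi2NormVec P (x i) ≤ ENNReal.ofReal K) :
    1 ≤ K ∧ (d ≤ n → ∃ E : Set Ω, MeasurableSet E ∧
      ENNReal.ofReal (1 - 2 * Real.exp (-(d : ℝ))) ≤ P E ∧
      ∀ ω ∈ E, ∀ v : EuclideanSpace ℝ (Fin d),
        |(n : ℝ)⁻¹ * ‖Matrix.toEuclideanLin (Matrix.of fun i j => x i ω j) v‖ ^ 2 - ‖v‖ ^ 2|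
          ≤ 2944 * K ^ 2 * Real.sqrt ((d : ℝ) / n) * ‖v‖ ^ 2) := by
  have hpsi' : ∀ i u, ‖u‖ = 1 → psi2Norm P (fun ω => inner ℝ (x i ω) u) ≤ ENNReal.ofReal K :=
    fun i u hu => (le_iSup₂ (f := fun (u : EuclideanSpace ℝ (Fin d)) (_ : ‖u‖ = 1) =>
      psi2Norm P (fun ω => inner ℝ (x i ω) u)) u hu).trans (hpsi i)
  have hmu : ∀ i u, Measurable fun ω => inner ℝ (x i ω) u := fun i u => by
    have := hm i; fun_prop
  have hK : 1 ≤ K := by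
    let u : EuclideanSpace ℝ (Fin d) := EuclideanSpace.single ⟨0, hd⟩ 1
    have hu : ‖u‖ = 1 := by simp [u]
    obtain ⟨h1, h2⟩ := (hiso ⟨0, hn⟩).inner_sq u
    exact one_le_of_psi2Norm_le (hmu _ u) (hpsi' ⟨0, hn⟩ u hu) h1 (by rw [h2, hu, one_pow])
  refine ⟨hK, fun hdn => ?_⟩
  have hn0 : (0 : ℝ) < n := by exact_mod_cast hn
  have hd0 : (0 : ℝ) < d := by exact_mod_cast hd
  have hr0 : 0 ≤ (d : ℝ) / n := by positivity
  have hr1 : Real.sqrt ((d : ℝ) / n) ≤ 1 := by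
    rw [Real.sqrt_le_one, div_le_one hn0]
    exact_mod_cast hdn
  set T : ℝ := 4 * K ^ 2 with hT
  have hT1 : 1 ≤ T := by nlinarith
  -- Since `23² = 529 ≥ 3 · 176`, each net point fails with probability at most `2e^{-3d}`, and a
  -- union over `5^d ≤ e^{2d}` points leaves `2e^{-d}`. The final constant is `2944 = 32 · 23 · 4`.
  set δ : ℝ := 23 * T * Real.sqrt ((d : ℝ) / n) with hδ
  have hδ0 : 0 ≤ δ := by positivity
  have hδT : δ ≤ 44 * T := by
    rw [hδ]; nlinarith
  obtain ⟨N, hN1, hNc, hN⟩ := exists_half_net d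
  let B : EuclideanSpace ℝ (Fin d) → Set Ω := fun u =>
    {ω | n * δ ≤ |∑ i, (inner ℝ (x i ω) u ^ 2 - 1)|}
  have hBm : ∀ u, MeasurableSet (B u) := fun u =>
    measurableSet_le measurable_const (by have := fun i => hmu i u; fun_prop)
  have hB : ∀ u ∈ N, P.real (B u) ≤ 2 * Real.exp (-(3 * d)) := by
    intro u hu
    have hu1 := hN1 u hu
    have hb := measure_abs_sum_sub_one_ge_le (P := P) (s := fun i ω => inner ℝ (x i ω) u ^ 2)
      (T := T) (δ := δ) (fun i => (hmu i u).pow_const 2) (fun i ω => sq_nonneg _) hT1 ?_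
      (fun i => ((hiso i).inner_sq u).1)
      (fun i => by rw [((hiso i).inner_sq u).2, hu1, one_pow]) ?_ hδ0 hδT
    · refine hb.trans ?_
      gcongr
      have hval : (n : ℝ) * δ ^ 2 = 529 * T ^ 2 * d := by
        rw [hδ, mul_pow, Real.sq_sqrt hr0]
        field_simp
        norm_num
      rw [le_div_iff₀ (by positivity), hval]
      nlinarith [mul_pos hd0 (by positivity : 0 < T ^ 2)]
    · intro i
      have := lintegral_exp_le_of_psi2Norm_le (hpsi' i u hu1) (t := 2 * K) (by linarith)
        (by linarith)
      rwa [show (2 * K) ^ 2 = T by rw [hT]; ring] at this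
    · exact hind.comp (fun _ y => inner ℝ y u ^ 2) fun _ => by fun_prop
  have hBad : P.real (⋃ u ∈ N, B u) ≤ 2 * Real.exp (-(d : ℝ)) := by
    have h5 : (5 : ℝ) ≤ Real.exp 2 := by
      have := Real.quadratic_le_exp_of_nonneg (x := 2) (by norm_num); linarith
    calc P.real (⋃ u ∈ N, B u) ≤ ∑ u ∈ N, P.real (B u) := measureReal_biUnion_finset_le _ _
      _ ≤ ∑ _u ∈ N, 2 * Real.exp (-(3 * d)) := Finset.sum_le_sum hB
      _ = N.card * (2 * Real.exp (-(3 * d))) := by rw [Finset.sum_const, nsmul_eq_mul]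
      _ ≤ (5 : ℝ) ^ d * (2 * Real.exp (-(3 * d))) := by gcongr; exact_mod_cast hNc
      _ ≤ (Real.exp 2) ^ d * (2 * Real.exp (-(3 * d))) := by gcongr
      _ = 2 * Real.exp (-(d : ℝ)) := by
        rw [← Real.exp_nat_mul, mul_left_comm, ← Real.exp_add]; ring_nf
  have hBadm : MeasurableSet (⋃ u ∈ N, B u) := N.measurableSet_biUnion fun u _ => hBm u
  refine ⟨(⋃ u ∈ N, B u)ᶜ, hBadm.compl, ?_, fun ω hω v => ?_⟩
  · rw [← ofReal_measureReal, probReal_compl_eq_one_sub hBadm]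
    exact ENNReal.ofReal_le_ofReal (by linarith)
  · have := abs_form_le_of_net
      (Matrix.toEuclideanLin (Matrix.of fun i j => x i ω j)).toContinuousLinearMap (n : ℝ)⁻¹ δ N
      hN1 hN ?_ v
    · refine this.trans_eq ?_
      rw [hδ, hT]; ring
    · intro u hu
      have hω' : ω ∉ B u := fun h => hω (mem_biUnion hu h)
      simp only [B, mem_ofPred_eq, not_le] at hω'
      rw [LinearMap.coe_toContinuousLinearMap', norm_sq_toEuclideanLin, hN1 u hu]
      rw [Finset.sum_sub_distrib] at hω'
      simp only [Finset.sum_const, Finset.card_univ, Fintype.card_fin, nsmul_eq_mul,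
        mul_one] at hω'
      rw [show (n : ℝ)⁻¹ * ∑ i, inner ℝ (x i ω) u ^ 2 - 1 ^ 2
        = (n : ℝ)⁻¹ * (∑ i, inner ℝ (x i ω) u ^ 2 - n) by field_simp, abs_mul,
        abs_of_pos (inv_pos.2 hn0), inv_mul_le_iff₀ hn0]
      exact hω'.le

end Design

/-! ### Integrability of Gaussian tilts -/

section GaussianTilt

/-- Exponential tilts with a Gaussian factor are integrable for every finite measure. -/
theorem integrable_exp_tilt (π : Measure ℝ) [IsFiniteMeasure π] {γ : ℝ} (hγ : 0 < γ) (x : ℝ) :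
    Integrable (fun θ => Real.exp (x * θ - γ / 2 * θ ^ 2)) π := by
  refine Integrable.of_bound (by fun_prop) (Real.exp (x ^ 2 / (2 * γ))) (ae_of_all _ fun θ => ?_)
  rw [Real.norm_eq_abs, Real.abs_exp, Real.exp_le_exp, le_div_iff₀ (by positivity)]
  nlinarith [sq_nonneg (x - γ * θ)]

theorem integrable_sq_mul_exp_tilt (π : Measure ℝ) [IsFiniteMeasure π] {γ : ℝ} (hγ : 0 < γ)
    (x c : ℝ) :
    Integrable (fun θ => (θ - c) ^ 2 * Real.exp (x * θ - γ / 2 * θ ^ 2)) π := by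
  have hdom := ((integrable_exp_tilt π hγ (x + 1)).const_mul (2 * Real.exp (-c))).add
    ((integrable_exp_tilt π hγ (x - 1)).const_mul (2 * Real.exp c))
  refine hdom.mono' (by fun_prop) (ae_of_all _ fun θ => ?_)
  have hsq : (θ - c) ^ 2 ≤ 2 * Real.exp (θ - c) + 2 * Real.exp (c - θ) := by
    have h1 := Real.quadratic_le_exp_of_nonneg (abs_nonneg (θ - c))
    have h2 : Real.exp |θ - c| ≤ Real.exp (θ - c) + Real.exp (c - θ) := by
      rcases abs_cases (θ - c) with ⟨h, _⟩ | ⟨h, _⟩ <;> rw [h]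
      · linarith [Real.exp_pos (c - θ)]
      · rw [neg_sub]; linarith [Real.exp_pos (θ - c)]
    rw [sq_abs] at h1
    linarith [abs_nonneg (θ - c)]
  rw [Real.norm_eq_abs, abs_of_nonneg (by positivity)]
  calc (θ - c) ^ 2 * Real.exp (x * θ - γ / 2 * θ ^ 2)
      ≤ (2 * Real.exp (θ - c) + 2 * Real.exp (c - θ)) * Real.exp (x * θ - γ / 2 * θ ^ 2) := by
        gcongr
    _ = _ := by
        simp only [Pi.add_apply, add_mul, mul_assoc, ← Real.exp_add]
        ring_nf

end GaussianTilt

/-! ### The tilted slab: mode, second moment and mass -/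

section Slab

variable {f : ℝ → ℝ}

theorem continuous_of_concaveOn_log (hpos : ∀ x, 0 < f x)
    (hconc : ConcaveOn ℝ univ fun x => Real.log (f x)) : Continuous f := by
  have h : Continuous fun x => Real.log (f x) :=
    continuousOn_univ.1 (hconc.continuousOn isOpen_univ)
  simpa only [Real.exp_log (hpos _)] using h.rexp

/-- `s` lies between `±|t|`, where `log f` takes equal values, and a concave function is at least
the minimum of its endpoint values. -/
theorem apply_le_of_abs_le (hpos : ∀ x, 0 < f x)
    (hconc : ConcaveOn ℝ univ fun x => Real.log (f x)) (heven : ∀ x, f (-x) = f x) {s t : ℝ}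
    (hst : |s| ≤ |t|) : f t ≤ f s := by
  have hmem : s ∈ segment ℝ (-|t|) |t| := by
    rw [segment_eq_Icc (by linarith [abs_nonneg t])]
    exact abs_le.1 hst
  have habs : f |t| = f t := by
    rcases abs_choice t with h | h <;> rw [h]
    exact heven t
  have h := hconc.ge_on_segment (mem_univ _) (mem_univ _) hmem
  simp only [heven, min_self, habs] at h
  exact (Real.log_le_log_iff (hpos _) (hpos _)).1 h

/-- An even log-concave density times a Gaussian tilt has a mode in `[-|x| / γ, |x| / γ]`. -/
theorem exists_mode (hpos : ∀ x, 0 < f x)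
    (hconc : ConcaveOn ℝ univ fun x => Real.log (f x)) (heven : ∀ x, f (-x) = f x)
    {γ : ℝ} (hγ : 0 < γ) (x : ℝ) :
    ∃ c, |c| ≤ |x| / γ ∧ ∀ θ, f θ * Real.exp (x * θ - γ / 2 * θ ^ 2) ≤
      f c * Real.exp (x * c - γ / 2 * c ^ 2) := by
  wlog hx : 0 ≤ x generalizing x
  · obtain ⟨c, hc, hmax⟩ := this (-x) (by linarith)
    refine ⟨-c, by simpa using hc, fun θ => ?_⟩
    have := hmax (-θ)
    rw [heven] at this ⊢
    convert this using 3 <;> ring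
  have hcont := continuous_of_concaveOn_log hpos hconc
  have hmid : 0 ≤ x / γ := by positivity
  -- It suffices to maximise over `[0, x/γ]`: beyond `x/γ` both factors decrease, and a negative `θ`
  -- does no better than `-θ`.
  obtain ⟨c, hc, hmax⟩ := (isCompact_Icc (a := 0) (b := x / γ)).exists_isMaxOn
    ⟨0, left_mem_Icc.2 hmid⟩
    (f := fun θ => f θ * Real.exp (x * θ - γ / 2 * θ ^ 2)) (by fun_prop)
  refine ⟨c, by rw [abs_of_nonneg hc.1, abs_of_nonneg hx]; exact hc.2, ?_⟩
  have hnonneg : ∀ θ, 0 ≤ θ → f θ * Real.exp (x * θ - γ / 2 * θ ^ 2) ≤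
      f c * Real.exp (x * c - γ / 2 * c ^ 2) := by
    intro θ hθ
    rcases le_total θ (x / γ) with h | h
    · exact hmax ⟨hθ, h⟩
    · refine le_trans ?_ (hmax (right_mem_Icc.2 hmid))
      have hf : f θ ≤ f (x / γ) :=
        apply_le_of_abs_le hpos hconc heven (by rwa [abs_of_nonneg hmid, abs_of_nonneg hθ])
      have he : x * θ - γ / 2 * θ ^ 2 ≤ x * (x / γ) - γ / 2 * (x / γ) ^ 2 := by
        have : x * (x / γ) - γ / 2 * (x / γ) ^ 2 - (x * θ - γ / 2 * θ ^ 2)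
          = γ / 2 * (θ - x / γ) ^ 2 := by field_simp; ring
        have : 0 ≤ γ / 2 * (θ - x / γ) ^ 2 := by positivity
        linarith
      exact mul_le_mul hf (Real.exp_le_exp.2 he) (Real.exp_pos _).le (hpos _).le
  intro θ
  rcases le_total 0 θ with h | h
  · exact hnonneg θ h
  · refine le_trans ?_ (hnonneg (-θ) (by linarith))
    rw [heven]
    have := (hpos θ).le
    gcongr 2
    nlinarith

/-- The log of the tilted density is `γ`-strongly concave, so at the midpoint of `s + c` and `c` it
gains `γ s²/8` over the average of its end values, hence over its value at `s + c`. Then `exp z ≥ 1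
+ z`. -/
theorem mode_contraction (hpos : ∀ x, 0 < f x)
    (hconc : ConcaveOn ℝ univ fun x => Real.log (f x)) {γ x c : ℝ}
    (hc : ∀ θ, f θ * Real.exp (x * θ - γ / 2 * θ ^ 2) ≤
      f c * Real.exp (x * c - γ / 2 * c ^ 2)) (s : ℝ) :
    f (s + c) * Real.exp (x * (s + c) - γ / 2 * (s + c) ^ 2) * (1 + γ / 8 * s ^ 2) ≤
      f (s / 2 + c) * Real.exp (x * (s / 2 + c) - γ / 2 * (s / 2 + c) ^ 2) := by
  have hrw : ∀ θ r, f θ * Real.exp r = Real.exp (Real.log (f θ) + r) := fun θ r => by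
    rw [Real.exp_add, Real.exp_log (hpos θ)]
  have h1 := hc (s + c)
  have h2 := hconc.2 (mem_univ (s + c)) (mem_univ c) (by norm_num : (0 : ℝ) ≤ 1 / 2)
    (by norm_num : (0 : ℝ) ≤ 1 / 2) (by norm_num)
  simp only [smul_eq_mul] at h2
  rw [show 1 / 2 * (s + c) + 1 / 2 * c = s / 2 + c by ring] at h2
  rw [hrw, hrw, Real.exp_le_exp] at h1
  have h3 : 1 + γ / 8 * s ^ 2 ≤ Real.exp (γ / 8 * s ^ 2) := by
    linarith [Real.add_one_le_exp (γ / 8 * s ^ 2)]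
  rw [hrw, hrw]
  refine (mul_le_mul_of_nonneg_left h3 (Real.exp_pos _).le).trans ?_
  rw [← Real.exp_add, Real.exp_le_exp]
  nlinarith

variable {μ : Measure ℝ}

theorem integral_slab (hpos : ∀ x, 0 < f x) (hcont : Continuous f)
    (hμ : μ = volume.withDensity fun x => ENNReal.ofReal (f x)) (φ : ℝ → ℝ) :
    ∫ θ, φ θ ∂μ = ∫ θ, f θ * φ θ := by
  rw [hμ, integral_withDensity_eq_integral_toReal_smul (by fun_prop)
    (ae_of_all _ fun _ => ENNReal.ofReal_lt_top)]
  simp [ENNReal.toReal_ofReal (hpos _).le]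

theorem integrable_slab (hpos : ∀ x, 0 < f x) (hcont : Continuous f)
    (hμ : μ = volume.withDensity fun x => ENNReal.ofReal (f x)) {φ : ℝ → ℝ}
    (hφ : Integrable φ μ) : Integrable fun θ => f θ * φ θ := by
  rw [hμ, integrable_withDensity_iff_integrable_smul' (by fun_prop)
    (ae_of_all _ fun _ => ENNReal.ofReal_lt_top)] at hφ
  simpa [ENNReal.toReal_ofReal (hpos _).le] using hφ

/-- The tilted slab has second moment at most `8 / γ` about its mode. -/
theorem integral_sq_tilt_slab_le [IsFiniteMeasure μ] (hpos : ∀ x, 0 < f x)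
    (hconc : ConcaveOn ℝ univ fun x => Real.log (f x))
    (hμ : μ = volume.withDensity fun x => ENNReal.ofReal (f x)) {γ x c : ℝ} (hγ : 0 < γ)
    (hc : ∀ θ, f θ * Real.exp (x * θ - γ / 2 * θ ^ 2) ≤
      f c * Real.exp (x * c - γ / 2 * c ^ 2)) :
    ∫ θ, (θ - c) ^ 2 * Real.exp (x * θ - γ / 2 * θ ^ 2) ∂μ ≤
      8 / γ * ∫ θ, Real.exp (x * θ - γ / 2 * θ ^ 2) ∂μ := by
  have hcont := continuous_of_concaveOn_log hpos hconc
  have hi0 := integrable_slab hpos hcont hμ (integrable_exp_tilt μ hγ x)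
  have hi2 := integrable_slab hpos hcont hμ (integrable_sq_mul_exp_tilt μ hγ x c)
  rw [integral_slab hpos hcont hμ, integral_slab hpos hcont hμ]
  set G : ℝ → ℝ := fun θ => f θ * Real.exp (x * θ - γ / 2 * θ ^ 2) with hG
  have hi2' : Integrable fun θ => (θ - c) ^ 2 * G θ := hi2.congr (ae_of_all _ fun θ => by
    simp only [hG]; ring)
  -- The dilation doubles the mass, so integrating `mode_contraction` gives `Z + (γ/8)·(second
  -- moment) ≤ 2Z`.
  have hshift : ∫ s, G (s / 2 + c) = 2 * ∫ θ, G θ := by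
    rw [Measure.integral_comp_div (fun t => G (t + c)) 2, integral_add_right_eq_self G c]
    norm_num
  have hishift : Integrable fun s => G (s / 2 + c) :=
    (hi0.comp_add_right c).comp_div (two_ne_zero)
  have hile : Integrable fun s => G (s + c) * (1 + γ / 8 * s ^ 2) := by
    have h := (hi0.add (hi2'.const_mul (γ / 8))).comp_add_right c
    refine h.congr (ae_of_all _ fun s => ?_)
    simp only [Pi.add_apply, hG, add_sub_cancel_right]; ring
  have hle : ∫ s, G (s + c) * (1 + γ / 8 * s ^ 2) ≤ ∫ s, G (s / 2 + c) :=
    integral_mono hile hishift fun s => mode_contraction hpos hconc hc s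
  have hval : ∫ s, G (s + c) * (1 + γ / 8 * s ^ 2)
      = (∫ θ, G θ) + γ / 8 * ∫ θ, (θ - c) ^ 2 * G θ := by
    rw [← integral_const_mul, ← integral_add hi0 (hi2'.const_mul _),
      ← integral_add_right_eq_self (fun θ => G θ + γ / 8 * ((θ - c) ^ 2 * G θ)) c]
    congr 1
    funext s
    simp only [add_sub_cancel_right]; ring
  rw [hval, hshift] at hle
  have heq : ∫ θ, f θ * ((θ - c) ^ 2 * Real.exp (x * θ - γ / 2 * θ ^ 2))
      = ∫ θ, (θ - c) ^ 2 * G θ := by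
    congr 1; funext θ; simp only [hG]; ring
  rw [heq, div_mul_eq_mul_div, le_div_iff₀ hγ]
  linarith

/-- Lower bound on the mass of the tilted slab from an interval left of the Gaussian mode. -/
theorem le_integral_tilt_slab [IsFiniteMeasure μ] (hpos : ∀ x, 0 < f x)
    (hconc : ConcaveOn ℝ univ fun x => Real.log (f x)) (heven : ∀ x, f (-x) = f x)
    (hμ : μ = volume.withDensity fun x => ENNReal.ofReal (f x)) {γ x a b : ℝ} (hγ : 0 < γ)
    (ha : -1 ≤ a) (hab : a ≤ b) (hb : b ≤ 1) (hbx : b ≤ x / γ) :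
    f 1 * (b - a) * Real.exp (x * a - γ / 2 * a ^ 2) ≤
      ∫ θ, Real.exp (x * θ - γ / 2 * θ ^ 2) ∂μ := by
  have hcont := continuous_of_concaveOn_log hpos hconc
  have hi0 := integrable_slab hpos hcont hμ (integrable_exp_tilt μ hγ x)
  rw [integral_slab hpos hcont hμ]
  rw [le_div_iff₀ hγ] at hbx
  calc f 1 * (b - a) * Real.exp (x * a - γ / 2 * a ^ 2)
      = ∫ _θ in Icc a b, f 1 * Real.exp (x * a - γ / 2 * a ^ 2) := by
        rw [setIntegral_const, Real.volume_real_Icc_of_le hab, smul_eq_mul]; ring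
    _ ≤ ∫ θ in Icc a b, f θ * Real.exp (x * θ - γ / 2 * θ ^ 2) := by
        refine setIntegral_mono_on continuous_const.integrableOn_Icc hi0.integrableOn measurableSet_Icc
          fun θ hθ => ?_
        have hf : f 1 ≤ f θ := apply_le_of_abs_le hpos hconc heven (by
          rw [abs_one, abs_le]; constructor <;> linarith [hθ.1, hθ.2])
        -- The exponent increases up to its peak `x/γ ≥ b`, so on `[a, b]` it is smallest at `a`.
        refine mul_le_mul hf (Real.exp_le_exp.2 ?_) (Real.exp_pos _).le (hpos _).le
        nlinarith [mul_nonneg (sub_nonneg.2 hθ.1) (sub_nonneg.2 hθ.2), hθ.1, hθ.2,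
          mul_nonneg (sub_nonneg.2 hθ.1) (by nlinarith [hθ.2] : 0 ≤ x - γ * θ),
          mul_nonneg (sub_nonneg.2 hθ.1) (mul_nonneg hγ.le (sub_nonneg.2 hθ.1))]
    _ ≤ _ := setIntegral_le_integral hi0 (ae_of_all _ fun θ =>
        mul_nonneg (hpos θ).le (Real.exp_pos _).le)

theorem integral_tilt_slab_abs (hpos : ∀ x, 0 < f x) (hcont : Continuous f)
    (heven : ∀ x, f (-x) = f x)
    (hμ : μ = volume.withDensity fun x => ENNReal.ofReal (f x)) (γ x : ℝ) :
    ∫ θ, Real.exp (|x| * θ - γ / 2 * θ ^ 2) ∂μ = ∫ θ, Real.exp (x * θ - γ / 2 * θ ^ 2) ∂μ := by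
  rcases abs_choice x with h | h <;> rw [h]
  rw [integral_slab hpos hcont hμ, integral_slab hpos hcont hμ, ← integral_neg_eq_self]
  congr 1; funext θ
  rw [heven]; ring_nf

/-- The source of the logarithm. If `x²/γ ≥ 2 log γ`, a window of width `γ^{-1/2}` ending at `x/γ`
has tilted mass at least of order `γ^{-1/2} exp(x²/(2γ)) ≥ exp(x²/(4γ))`, which dominates `x²/γ`. -/
theorem sq_le_mass_tilt_slab [IsFiniteMeasure μ] (hpos : ∀ x, 0 < f x)
    (hconc : ConcaveOn ℝ univ fun x => Real.log (f x)) (heven : ∀ x, f (-x) = f x)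
    (hμ : μ = volume.withDensity fun x => ENNReal.ofReal (f x)) {γ : ℝ} (hγ : 1 ≤ γ) (x : ℝ) :
    (x / γ) ^ 2 ≤ 2 * Real.log γ / γ ∨
      (x / γ) ^ 2 ≤ 29 / (f 1 * γ) * ∫ θ, Real.exp (x * θ - γ / 2 * θ ^ 2) ∂μ := by
  have hγ0 : 0 < γ := by linarith
  have hf1 := hpos 1
  rw [← integral_tilt_slab_abs hpos (continuous_of_concaveOn_log hpos hconc) heven hμ γ x,
    ← sq_abs, abs_div, abs_of_pos hγ0]
  have hx := abs_nonneg x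
  generalize |x| = x at hx
  rcases le_total x γ with hxγ | hxγ
  · rcases le_total (x ^ 2 / γ) (2 * Real.log γ) with hu | hu
    · left
      rw [div_pow, sq γ, ← div_div]
      gcongr
    · right
      set r := 1 / Real.sqrt γ with hr
      have hs0 : 0 < Real.sqrt γ := Real.sqrt_pos.2 hγ0
      have hr1 : r ≤ 1 := by rw [hr, div_le_one hs0, Real.one_le_sqrt]; exact hγ
      have hr0 : 0 < r := by positivity
      have hrsq : γ * r ^ 2 = 1 := by
        rw [hr, div_pow, Real.sq_sqrt hγ0.le]; field_simp
      have hxγ0 : 0 ≤ x / γ := by positivity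
      have hxγ1 : x / γ ≤ 1 := by rwa [div_le_one hγ0]
      have hZ := le_integral_tilt_slab hpos hconc heven hμ hγ0 (x := x) (a := x / γ - r)
        (b := x / γ) (by linarith) (by linarith) hxγ1 le_rfl
      have hexp : x * (x / γ - r) - γ / 2 * (x / γ - r) ^ 2 = x ^ 2 / γ / 2 - 1 / 2 := by
        have : x * (x / γ - r) - γ / 2 * (x / γ - r) ^ 2 = x ^ 2 / γ / 2 - γ * r ^ 2 / 2 := by
          field_simp; ring
        rw [this, hrsq]
      rw [hexp, sub_sub_cancel] at hZ
      have hrexp : r = Real.exp (-(Real.log γ / 2)) := by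
        rw [Real.exp_neg, Real.exp_half, Real.exp_log hγ0, hr, one_div]
      have hlow : x ^ 2 / γ / 29 ≤ r * Real.exp (x ^ 2 / γ / 2 - 1 / 2) := by
        rw [hrexp, ← Real.exp_add]
        refine le_trans ?_ (Real.exp_le_exp.2
          (by linarith : -1 / 2 + x ^ 2 / γ / 4 ≤ -(Real.log γ / 2) + (x ^ 2 / γ / 2 - 1 / 2)))
        have := Real.add_one_le_exp (-1 / 2 + x ^ 2 / γ / 4)
        have : 0 ≤ x ^ 2 / γ := by positivity
        linarith
      rw [div_mul_eq_mul_div, le_div_iff₀ (by positivity)]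
      calc (x / γ) ^ 2 * (f 1 * γ) = 29 * (f 1 * (x ^ 2 / γ / 29)) := by field_simp
        _ ≤ 29 * (f 1 * (r * Real.exp (x ^ 2 / γ / 2 - 1 / 2))) := by gcongr
        _ ≤ _ := by rw [← mul_assoc (f 1)]; gcongr
  · right
    -- Now `x/γ` may lie far out where `f` is small, so a fixed window is used; its exponent is
    -- still at least `3x/8`, and `exp z ≥ z²/2` gives `9/256 ≥ 1/29`.
    have hZ := le_integral_tilt_slab hpos hconc heven hμ hγ0 (x := x) (a := 1 / 2)
      (b := 1) (by norm_num) (by norm_num) le_rfl (by rwa [one_le_div hγ0])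
    have hlow : x ^ 2 / 29 ≤ 1 / 2 * Real.exp (x * (1 / 2) - γ / 2 * (1 / 2) ^ 2) := by
      have h1 := Real.quadratic_le_exp_of_nonneg (x := 3 / 8 * x) (by positivity)
      have h2 : Real.exp (3 / 8 * x) ≤ Real.exp (x * (1 / 2) - γ / 2 * (1 / 2) ^ 2) :=
        Real.exp_le_exp.2 (by linarith)
      nlinarith
    rw [div_mul_eq_mul_div, le_div_iff₀ (by positivity)]
    calc (x / γ) ^ 2 * (f 1 * γ) = 29 * (f 1 * (x ^ 2 / 29)) / γ := by field_simp
      _ ≤ 29 * (f 1 * (x ^ 2 / 29)) := div_le_self (by positivity) hγ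
      _ ≤ 29 * (f 1 * (1 / 2 * Real.exp (x * (1 / 2) - γ / 2 * (1 / 2) ^ 2))) := by gcongr
      _ ≤ _ := by
        gcongr
        refine le_trans (le_of_eq ?_) hZ
        ring

end Slab

/-! ### The potential as a cumulant generating function -/

section Potential

theorem integral_spikeSlab {q : ℝ} (hq : q ∈ Icc (0 : ℝ) 1) (μ : Measure ℝ) {φ : ℝ → ℝ}
    (hφ : Integrable φ μ) :
    ∫ θ, φ θ ∂(spikeSlab q μ) = (1 - q) * φ 0 + q * ∫ θ, φ θ ∂μ := by
  rw [spikeSlab, integral_add_measure ((integrable_dirac (by simp)).smul_measure (by simp))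
    (hφ.smul_measure (by simp)), integral_smul_measure, integral_smul_measure, integral_dirac,
    ENNReal.toReal_ofReal (by linarith [hq.2]), ENNReal.toReal_ofReal hq.1]
  rfl

theorem isProbabilityMeasure_spikeSlab {q : ℝ} (hq : q ∈ Icc (0 : ℝ) 1) (μ : Measure ℝ)
    [IsProbabilityMeasure μ] : IsProbabilityMeasure (spikeSlab q μ) := by
  constructor
  simp only [spikeSlab, Measure.coe_add, Measure.coe_smul, Pi.add_apply, Pi.smul_apply,
    measure_univ, smul_eq_mul, mul_one]
  rw [← ENNReal.ofReal_add (by linarith [hq.2]) hq.1]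
  simp

variable (π : Measure ℝ)

/-- The measure with density `exp (-γ θ² / 2)` with respect to `π`. -/
noncomputable def gaussianDamping (γ : ℝ) : Measure ℝ :=
  π.withDensity fun θ => ENNReal.ofReal (Real.exp (-(γ / 2 * θ ^ 2)))

theorem integral_gaussianDamping (γ x : ℝ) (φ : ℝ → ℝ) :
    ∫ θ, φ θ * Real.exp (x * θ) ∂(gaussianDamping π γ)
      = ∫ θ, φ θ * Real.exp (x * θ - γ / 2 * θ ^ 2) ∂π := by
  rw [gaussianDamping, integral_withDensity_eq_integral_toReal_smul (by fun_prop)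
    (ae_of_all _ fun _ => ENNReal.ofReal_lt_top)]
  congr 1; funext θ
  rw [ENNReal.toReal_ofReal (Real.exp_pos _).le, sub_eq_add_neg, Real.exp_add, smul_eq_mul]
  ring

theorem mgf_gaussianDamping (γ x : ℝ) :
    mgf id (gaussianDamping π γ) x = ∫ θ, Real.exp (x * θ - γ / 2 * θ ^ 2) ∂π := by
  simpa [mgf] using integral_gaussianDamping π γ x fun _ => 1

/-- With the Gaussian factor moved into the measure, smoothness of `V_γ` and the variance formula
for `V_γ''` follow from the theory of moment generating functions. -/
theorem potentialV_eq_neg_cgf (γ : ℝ) :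
    potentialV π γ = -cgf id (gaussianDamping π γ) := by
  funext x
  rw [Pi.neg_apply, cgf, mgf_gaussianDamping, potentialV]

variable [IsFiniteMeasure π] {γ : ℝ}

theorem integrableExpSet_gaussianDamping (hγ : 0 < γ) :
    interior (integrableExpSet id (gaussianDamping π γ)) = univ := by
  rw [show integrableExpSet id (gaussianDamping π γ) = univ from ?_, interior_univ]
  refine eq_univ_of_forall fun x => ?_
  rw [integrableExpSet, mem_ofPred_eq, gaussianDamping,
    integrable_withDensity_iff_integrable_smul' (by fun_prop)
    (ae_of_all _ fun _ => ENNReal.ofReal_lt_top)]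
  refine (integrable_exp_tilt π hγ x).congr (ae_of_all _ fun θ => ?_)
  simp only [id, smul_eq_mul]
  rw [ENNReal.toReal_ofReal (Real.exp_pos _).le, ← Real.exp_add]
  ring_nf

theorem contDiff_potentialV (hγ : 0 < γ) : ContDiff ℝ 2 (potentialV π γ) := by
  rw [potentialV_eq_neg_cgf, contDiff_iff_contDiffAt]
  intro x
  have hx : x ∈ interior (integrableExpSet id (gaussianDamping π γ)) := by
    rw [integrableExpSet_gaussianDamping π hγ]; trivial
  exact (analyticAt_cgf hx).neg.contDiffAt

theorem integral_exp_tilt_pos [NeZero π] (hγ : 0 < γ) (x : ℝ) :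
    0 < ∫ θ, Real.exp (x * θ - γ / 2 * θ ^ 2) ∂π :=
  integral_exp_pos (integrable_exp_tilt π hγ x)

/-- The second derivative of `V_γ` is minus a variance, hence at least minus any second moment. -/
theorem neg_le_iteratedDeriv_two_potentialV [NeZero π] (hγ : 0 < γ)
    {x c M : ℝ}
    (h : ∫ θ, (θ - c) ^ 2 * Real.exp (x * θ - γ / 2 * θ ^ 2) ∂π ≤
      M * ∫ θ, Real.exp (x * θ - γ / 2 * θ ^ 2) ∂π) :
    -M ≤ iteratedDeriv 2 (potentialV π γ) x := by
  have hx : x ∈ interior (integrableExpSet id (gaussianDamping π γ)) := by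
    rw [integrableExpSet_gaussianDamping π hγ]; trivial
  have hZ := integral_exp_tilt_pos π hγ x
  rw [potentialV_eq_neg_cgf, iteratedDeriv_neg, neg_le_neg_iff, iteratedDeriv_two_cgf hx,
    deriv_cgf hx, mgf_gaussianDamping]
  simp only [id]
  rw [integral_gaussianDamping π γ x fun θ => θ ^ 2, integral_gaussianDamping π γ x fun θ => θ]
  have hi0 := integrable_exp_tilt π hγ x
  have hi2 : Integrable (fun θ => θ ^ 2 * Real.exp (x * θ - γ / 2 * θ ^ 2)) π := by
    simpa using integrable_sq_mul_exp_tilt π hγ x 0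
  have hi1 : Integrable (fun θ => θ * Real.exp (x * θ - γ / 2 * θ ^ 2)) π := by
    refine (hi0.add hi2).mono' (by fun_prop) (ae_of_all _ fun θ => ?_)
    rw [norm_mul, Real.norm_eq_abs, Real.norm_eq_abs, Real.abs_exp, Pi.add_apply, ← one_add_mul]
    gcongr
    nlinarith [sq_abs θ, sq_nonneg (|θ| - 1)]
  have hexp : ∫ θ, (θ - c) ^ 2 * Real.exp (x * θ - γ / 2 * θ ^ 2) ∂π
      = ∫ θ, θ ^ 2 * Real.exp (x * θ - γ / 2 * θ ^ 2) ∂π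
        - 2 * c * ∫ θ, θ * Real.exp (x * θ - γ / 2 * θ ^ 2) ∂π
        + c ^ 2 * ∫ θ, Real.exp (x * θ - γ / 2 * θ ^ 2) ∂π := by
    have hi21 : Integrable (fun θ => θ ^ 2 * Real.exp (x * θ - γ / 2 * θ ^ 2)
        - 2 * c * (θ * Real.exp (x * θ - γ / 2 * θ ^ 2))) π := hi2.sub (hi1.const_mul _)
    rw [← integral_const_mul, ← integral_const_mul, ← integral_sub hi2 (hi1.const_mul _),
      ← integral_add hi21 (hi0.const_mul _)]
    congr 1; funext θ; ring
  rw [hexp] at h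
  set E2 := ∫ θ, θ ^ 2 * Real.exp (x * θ - γ / 2 * θ ^ 2) ∂π
  set E1 := ∫ θ, θ * Real.exp (x * θ - γ / 2 * θ ^ 2) ∂π
  set Z := ∫ θ, Real.exp (x * θ - γ / 2 * θ ^ 2) ∂π
  have h1 : E2 / Z - 2 * c * (E1 / Z) + c ^ 2 ≤ M := by
    have := div_le_div_of_nonneg_right h hZ.le
    rw [mul_div_cancel_right₀ _ hZ.ne'] at this
    refine le_trans (le_of_eq ?_) this
    field_simp
  -- The second moment about `c` exceeds the variance by `(E1 / Z - c)²`.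
  nlinarith [sq_nonneg (E1 / Z - c)]

end Potential

/-! ### Uniform curvature bound for the spike-and-slab prior -/

/-- The curvature of `V_γ` for a spike-and-slab prior with an admissible slab is bounded below by
`-C (1 + log (γ + 1)) / γ`, uniformly in `x`. -/
theorem exists_curvature_bound {q : ℝ} (hq : q ∈ Icc (0 : ℝ) 1) (μ : Measure ℝ)
    [IsProbabilityMeasure μ] {f : ℝ → ℝ} (hpos : ∀ x, 0 < f x)
    (hconc : ConcaveOn ℝ univ fun x => Real.log (f x)) (heven : ∀ x, f (-x) = f x)
    (hμ : μ = volume.withDensity fun x => ENNReal.ofReal (f x)) :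
    ∃ C, 0 < C ∧ ∀ γ, 1 ≤ γ → ∀ x,
      -(C * (1 + Real.log (γ + 1)) / γ) ≤ iteratedDeriv 2 (potentialV (spikeSlab q μ) γ) x := by
  have hprob := isProbabilityMeasure_spikeSlab hq μ
  have hf1 := hpos 1
  -- `10 = 8 + 2` collects the slab and the near-spike case. For `q = 0` the quotient is `0` by
  -- convention, and the prior is a point mass of variance zero.
  refine ⟨10 + 29 / (f 1 * q), by have := hq.1; positivity, fun γ hγ x => ?_⟩
  have hγ0 : 0 < γ := by linarith
  obtain ⟨c, hc, hmax⟩ := exists_mode hpos hconc heven hγ0 x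
  have hi0 := integrable_exp_tilt μ hγ0 x
  have hsq := integral_sq_tilt_slab_le hpos hconc hμ hγ0 hmax
  have hZ0 := integral_exp_tilt_pos μ hγ0 x
  have hmass := sq_le_mass_tilt_slab hpos hconc heven hμ hγ x
  have hlog0 : 0 ≤ Real.log γ := Real.log_nonneg hγ
  have hlog : Real.log γ ≤ Real.log (γ + 1) := Real.log_le_log hγ0 (by linarith)
  rcases hq.1.eq_or_lt with hq0 | hq0
  · refine neg_le_iteratedDeriv_two_potentialV _ hγ0 (c := 0) ?_
    rw [integral_spikeSlab hq μ (integrable_sq_mul_exp_tilt μ hγ0 x 0),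
      integral_spikeSlab hq μ hi0, ← hq0]
    have : 0 ≤ Real.log (γ + 1) := hlog0.trans hlog
    simp
    positivity
  · refine neg_le_iteratedDeriv_two_potentialV _ hγ0 (c := c) ?_
    rw [integral_spikeSlab hq μ (integrable_sq_mul_exp_tilt μ hγ0 x c),
      integral_spikeSlab hq μ hi0]
    set Z := ∫ θ, Real.exp (x * θ - γ / 2 * θ ^ 2) ∂μ
    simp only [mul_zero, zero_sub, neg_sq, zero_pow two_ne_zero, sub_zero, Real.exp_zero, mul_one]
    have hc2 : c ^ 2 ≤ (x / γ) ^ 2 := by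
      rw [← sq_abs c, ← sq_abs (x / γ), abs_div, abs_of_pos hγ0]
      gcongr
    have hq1 : 0 ≤ 1 - q := by linarith [hq.2]
    set D := 29 / (f 1 * q) with hD
    have hD0 : 0 ≤ D := by positivity
    set l := 1 + Real.log (γ + 1) with hl
    have hl1 : 1 ≤ l := by linarith
    -- Either `c` is near the spike and its own mass `1 - q` pays, or the slab mass `q Z` does.
    have hspike : (1 - q) * c ^ 2 ≤ 2 * l / γ * (1 - q) + D / γ * (q * Z) := by
      rcases hmass with h | h
      · have h1 : c ^ 2 ≤ 2 * l / γ := (hc2.trans h).trans (by gcongr; linarith)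
        have : 0 ≤ D / γ * (q * Z) := by positivity
        nlinarith
      · have h1 : c ^ 2 ≤ D / γ * (q * Z) := by
          refine (hc2.trans h).trans (le_of_eq ?_)
          rw [hD]; field_simp
        have h2 : 0 ≤ 2 * l / γ * (1 - q) := by positivity
        have h3 : (1 - q) * c ^ 2 ≤ 1 * c ^ 2 := by gcongr; linarith
        linarith
    have hslab : q * (∫ θ, (θ - c) ^ 2 * Real.exp (x * θ - γ / 2 * θ ^ 2) ∂μ)
        ≤ 8 / γ * (q * Z) := by
      rw [mul_left_comm]; gcongr
    have hfin : 2 * l / γ * (1 - q) + D / γ * (q * Z) + 8 / γ * (q * Z) ≤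
        (10 + D) * l / γ * (1 - q + q * Z) := by
      have e : (10 + D) * l / γ * (1 - q + q * Z)
          - (2 * l / γ * (1 - q) + D / γ * (q * Z) + 8 / γ * (q * Z))
          = (8 + D) * l / γ * (1 - q) + (D * (l - 1) + 8 * (l - 1) + 2 * l) / γ * (q * Z) := by
        ring
      have h1 : 0 ≤ l - 1 := by linarith
      have : 0 ≤ (8 + D) * l / γ * (1 - q)
          + (D * (l - 1) + 8 * (l - 1) + 2 * l) / γ * (q * Z) := by positivity
      linarith
    linarith

/-! ### Quadratic forms of matrices -/

section MatrixForms

variable {d : ℕ}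

/-- If `a I ≤ A ≤ B I` with `a > 0` then `A⁻¹ ≥ B⁻¹ I`, as quadratic forms. -/
theorem inv_form_ge {A : Matrix (Fin d) (Fin d) ℝ} (hA : A.IsHermitian) {a B : ℝ} (ha : 0 < a)
    (hB : 0 < B) (hlo : ∀ v : Fin d → ℝ, a * (v ⬝ᵥ v) ≤ v ⬝ᵥ (A *ᵥ v))
    (hup : ∀ v : Fin d → ℝ, v ⬝ᵥ (A *ᵥ v) ≤ B * (v ⬝ᵥ v)) (v : Fin d → ℝ) :
    1 / B * (v ⬝ᵥ v) ≤ v ⬝ᵥ (A⁻¹ *ᵥ v) := by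
  have hpd : A.PosDef := by
    refine Matrix.posDef_iff_dotProduct_mulVec.2 ⟨hA, fun x hx => ?_⟩
    rw [star_trivial]
    refine lt_of_lt_of_le (mul_pos ha ?_) (hlo x)
    have := Matrix.dotProduct_star_self_pos_iff.2 hx
    rwa [star_trivial] at this
  set w := A⁻¹ *ᵥ v with hw
  have hAw : A *ᵥ w = v := by
    rw [hw, Matrix.mulVec_mulVec, Matrix.mul_nonsing_inv _ ((Matrix.isUnit_iff_isUnit_det _).1
      hpd.isUnit), Matrix.one_mulVec]
  have hsymm : w ⬝ᵥ (A *ᵥ v) = v ⬝ᵥ v := by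
    have hAt : Aᵀ = A := by
      rw [← Matrix.conjTranspose_eq_transpose_of_trivial]; exact hA.eq
    rw [Matrix.dotProduct_mulVec, ← Matrix.mulVec_transpose, hAt, hAw]
  -- Expanding the form of `A` at `A⁻¹v - v/B` avoids diagonalisation.
  have h0 : 0 ≤ (w - (1 / B) • v) ⬝ᵥ (A *ᵥ (w - (1 / B) • v)) :=
    le_trans (mul_nonneg ha.le 
      (Finset.sum_nonneg fun i _ => mul_self_nonneg _)) (hlo _)
  have hexp : (w - (1 / B) • v) ⬝ᵥ (A *ᵥ (w - (1 / B) • v))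
      = v ⬝ᵥ w - 2 * (1 / B) * (v ⬝ᵥ v) + (1 / B) ^ 2 * (v ⬝ᵥ (A *ᵥ v)) := by
    simp only [Matrix.mulVec_sub, Matrix.mulVec_smul, hAw, dotProduct_sub, sub_dotProduct,
      dotProduct_smul, smul_dotProduct, hsymm, smul_eq_mul, dotProduct_comm w v]
    ring
  have h1 : (1 / B) ^ 2 * (v ⬝ᵥ (A *ᵥ v)) ≤ 1 / B * (v ⬝ᵥ v) := by
    calc (1 / B) ^ 2 * (v ⬝ᵥ (A *ᵥ v)) ≤ (1 / B) ^ 2 * (B * (v ⬝ᵥ v)) := by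
          gcongr; exact hup v
      _ = _ := by field_simp
  rw [hexp] at h0
  linarith

theorem lambdaMin_mem_Icc (hd : 1 ≤ d) {S : Matrix (Fin d) (Fin d) ℝ} (hS : S.IsHermitian)
    {l u : ℝ} (hlo : ∀ v : Fin d → ℝ, l * (v ⬝ᵥ v) ≤ v ⬝ᵥ (S *ᵥ v))
    (hup : ∀ v : Fin d → ℝ, v ⬝ᵥ (S *ᵥ v) ≤ u * (v ⬝ᵥ v)) : lambdaMin S ∈ Icc l u := by
  have hspec : ∀ r ∈ spectrum ℝ S, r ∈ Icc l u := by
    intro r hr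
    rw [hS.spectrum_real_eq_range_eigenvalues] at hr
    obtain ⟨j, rfl⟩ := hr
    have hmul := hS.mulVec_eigenvectorBasis j
    set v : Fin d → ℝ := ⇑(hS.eigenvectorBasis j) with hv
    have hvv : v ⬝ᵥ v = 1 := by
      have h := hS.eigenvectorBasis.orthonormal.1 j
      have h2 := EuclideanSpace.real_norm_sq_eq (hS.eigenvectorBasis j)
      rw [h] at h2
      simp only [dotProduct, ← sq]
      linarith
    have h1 := hlo v
    have h2 := hup v
    rw [hmul, dotProduct_smul, hvv, smul_eq_mul, mul_one, mul_one] at h1 h2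
    exact ⟨h1, h2⟩
  -- For `d = 0` the `sInf` would be the default value `0`; here `d ≥ 1` supplies an eigenvalue.
  have hne : (spectrum ℝ S).Nonempty := by
    rw [hS.spectrum_real_eq_range_eigenvalues]
    exact ⟨_, ⟨0, hd⟩, rfl⟩
  obtain ⟨r, hr⟩ := hne
  exact ⟨le_csInf ⟨r, hr⟩ fun b hb => (hspec b hb).1,
    (csInf_le ⟨l, fun b hb => (hspec b hb).1⟩ hr).trans (hspec r hr).2⟩

/-- The convexity defect at `x`, `y` with weights `a`, `b` is exactly `a b` times the form at `x -
y`. -/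
theorem convexOn_form {N : Matrix (Fin d) (Fin d) ℝ}
    (hN : ∀ v : Fin d → ℝ, 0 ≤ v ⬝ᵥ (N *ᵥ v)) :
    ConvexOn ℝ univ fun φ : EuclideanSpace ℝ (Fin d) => φ.ofLp ⬝ᵥ (N *ᵥ φ.ofLp) := by
  refine ⟨convex_univ, fun x _ y _ a b ha hb hab => ?_⟩
  have h := mul_nonneg (mul_nonneg ha hb) (hN (x.ofLp - y.ofLp))
  obtain rfl : b = 1 - a := by linarith
  simp only [Matrix.mulVec_sub, dotProduct_sub, sub_dotProduct] at h
  simp only [WithLp.ofLp_add, WithLp.ofLp_smul, Matrix.mulVec_add, Matrix.mulVec_smul,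
    dotProduct_add, add_dotProduct, dotProduct_smul, smul_dotProduct, smul_eq_mul]
  linarith

end MatrixForms

/-! ### Strong convexity of the Hamiltonian -/

section Convexity

/-- A `C²` function with `V'' ≥ -M` becomes convex after adding `M t² / 2`, also after a shift. -/
theorem convexOn_shift_add_sq {V : ℝ → ℝ} (hV : ContDiff ℝ 2 V) {M : ℝ}
    (hM : ∀ t, -M ≤ iteratedDeriv 2 V t) (h : ℝ) :
    ConvexOn ℝ univ fun t => V (h + t) + M / 2 * t ^ 2 := by
  have hV1 : Differentiable ℝ V := hV.differentiable (by norm_num)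
  have hV2 : Differentiable ℝ (deriv V) := by
    have : ContDiff ℝ 1 (deriv V) := (contDiff_succ_iff_deriv (n := 1).1 hV).2.2
    exact this.differentiable (by norm_num)
  have hd1 : ∀ t, HasDerivAt (fun t => V (h + t) + M / 2 * t ^ 2) (deriv V (h + t) + M * t) t := by
    intro t
    have h1 := (hV1 (h + t)).hasDerivAt.comp_const_add h t
    have h2 := ((hasDerivAt_id t).pow 2).const_mul (M / 2)
    refine (h1.add h2).congr_deriv ?_
    simp only [id]; ring
  have hd2 : ∀ t, HasDerivAt (fun t => deriv V (h + t) + M * t)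
      (iteratedDeriv 2 V (h + t) + M) t := by
    intro t
    have h1 := (hV2 (h + t)).hasDerivAt.comp_const_add h t
    have h2 := (hasDerivAt_id t).const_mul M
    refine (h1.add h2).congr_deriv ?_
    rw [iteratedDeriv_succ, iteratedDeriv_one, mul_one]
  have hderiv : deriv (fun t => V (h + t) + M / 2 * t ^ 2) = fun t => deriv V (h + t) + M * t :=
    funext fun t => (hd1 t).deriv
  refine convexOn_univ_of_deriv2_nonneg (fun t => (hd1 t).differentiableAt) ?_ fun t => ?_
  · rw [hderiv]; exact fun t => (hd2 t).differentiableAt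
  · simp only [Function.iterate_succ, Function.iterate_zero, Function.comp_apply, id]
    rw [hderiv, (hd2 t).deriv]
    linarith [hM (h + t)]

theorem convexOn_finset_sum {E ι : Type*} [AddCommGroup E] [Module ℝ E] (s : Finset ι)
    {g : ι → E → ℝ} (hg : ∀ i ∈ s, ConvexOn ℝ univ (g i)) :
    ConvexOn ℝ univ fun x => ∑ i ∈ s, g i x := by
  classical
  induction s using Finset.induction_on with
  | empty => simpa using convexOn_const (0 : ℝ) convex_univ
  | insert i s hi ih =>
    simp only [Finset.sum_insert hi]
    exact (hg i (Finset.mem_insert_self i s)).add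
      (ih fun j hj => hg j (Finset.mem_insert_of_mem hj))

/-- Strong convexity of `H` from a lower bound on `A⁻¹` and a lower bound on `V_γ''`. -/
theorem strongConvexOn_hamiltonian {n d : ℕ} {π₀ : Measure ℝ} {σ γ : ℝ}
    {X : Matrix (Fin n) (Fin d) ℝ} (hV : ContDiff ℝ 2 (potentialV π₀ γ)) {M β : ℝ}
    (hM : ∀ t, -M ≤ iteratedDeriv 2 (potentialV π₀ γ) t)
    (hβ : ∀ v : Fin d → ℝ, β * (v ⬝ᵥ v) ≤ v ⬝ᵥ ((couplingMatrix σ γ X)⁻¹ *ᵥ v))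
    (y : Fin n → ℝ) : StrongConvexOn univ (β - M) (hamiltonian π₀ σ γ X y) := by
  rw [strongConvexOn_iff_convex]
  set h : Fin d → ℝ := (σ ^ 2)⁻¹ • (Xᵀ *ᵥ y) with hh
  -- `H - (β - M)‖φ‖²/2` splits into the form of `A⁻¹ - β` and the potentials with `M φᵢ²/2` added;
  -- both parts are convex.
  have hquad := (convexOn_form (N := (couplingMatrix σ γ X)⁻¹ - β • 1) fun v => by
    rw [Matrix.sub_mulVec, dotProduct_sub, Matrix.smul_mulVec, Matrix.one_mulVec, dotProduct_smul,
      smul_eq_mul]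
    linarith [hβ v]).smul (by norm_num : (0 : ℝ) ≤ 1 / 2)
  have hsum : ConvexOn ℝ univ fun φ : EuclideanSpace ℝ (Fin d) =>
      ∑ i, (potentialV π₀ γ (h i + φ i) + M / 2 * φ i ^ 2) :=
    convexOn_finset_sum _ fun i _ =>
      (convexOn_shift_add_sq hV hM (h i)).comp_linearMap
        (EuclideanSpace.proj i : EuclideanSpace ℝ (Fin d) →L[ℝ] ℝ).toLinearMap
  refine (hquad.add hsum).congr fun φ _ => ?_
  have hn : ‖φ‖ ^ 2 = ∑ i, φ i ^ 2 := EuclideanSpace.real_norm_sq_eq φ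
  have hdot : φ.ofLp ⬝ᵥ φ.ofLp = ‖φ‖ ^ 2 := by
    rw [hn, dotProduct]; simp only [sq]
  simp only [Pi.add_apply, smul_eq_mul, hamiltonian, ← hh]
  rw [Matrix.sub_mulVec, dotProduct_sub, Matrix.smul_mulVec, Matrix.one_mulVec, dotProduct_smul,
    smul_eq_mul, Finset.sum_add_distrib, ← Finset.mul_sum, ← hn, hdot]
  ring

end Convexity

/-! ### Feasibility and the choice of constants -/

/-- Deterministic feasibility: near-isometry of `X` and a curvature bound for `V_γ`. -/
theorem isFeasible_of_form_bounds {n d : ℕ} (hd : 1 ≤ d) {π₀ : Measure ℝ} {σ γ l u M : ℝ}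
    {X : Matrix (Fin n) (Fin d) ℝ} (hu0 : 0 ≤ u)
    (hlo : ∀ v : EuclideanSpace ℝ (Fin d), l * ‖v‖ ^ 2 ≤
      (σ ^ 2)⁻¹ * ‖Matrix.toEuclideanLin X v‖ ^ 2)
    (hup : ∀ v : EuclideanSpace ℝ (Fin d), (σ ^ 2)⁻¹ * ‖Matrix.toEuclideanLin X v‖ ^ 2 ≤
      u * ‖v‖ ^ 2) (hσ : 0 < σ)
    (huγ : u < γ) (hV : ContDiff ℝ 2 (potentialV π₀ γ))
    (hM : ∀ t, -M ≤ iteratedDeriv 2 (potentialV π₀ γ) t) (hMγ : M < 1 / (γ - l)) :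
    IsFeasible π₀ σ X := by
  have hform : ∀ v : Fin d → ℝ, v ⬝ᵥ (((σ ^ 2)⁻¹ • (Xᵀ * X)) *ᵥ v) =
      (σ ^ 2)⁻¹ * ‖Matrix.toEuclideanLin X (WithLp.toLp 2 v)‖ ^ 2 := by
    intro v
    rw [Matrix.smul_mulVec, dotProduct_smul, smul_eq_mul, EuclideanSpace.real_norm_sq_eq,
      ← Matrix.mulVec_mulVec, Matrix.dotProduct_mulVec, Matrix.vecMul_transpose]
    simp [dotProduct, sq, Matrix.toLpLin_apply]
  have hnorm : ∀ v : Fin d → ℝ, ‖WithLp.toLp 2 v‖ ^ 2 = v ⬝ᵥ v := by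
    intro v
    rw [EuclideanSpace.real_norm_sq_eq]; simp [dotProduct, sq]
  have hlo' : ∀ v : Fin d → ℝ, l * (v ⬝ᵥ v) ≤ v ⬝ᵥ (((σ ^ 2)⁻¹ • (Xᵀ * X)) *ᵥ v) := fun v => by
    rw [hform, ← hnorm]; exact hlo _
  have hup' : ∀ v : Fin d → ℝ, v ⬝ᵥ (((σ ^ 2)⁻¹ • (Xᵀ * X)) *ᵥ v) ≤ u * (v ⬝ᵥ v) := fun v => by
    rw [hform, ← hnorm]; exact hup _
  have hherm : ((σ ^ 2)⁻¹ • (Xᵀ * X)).IsHermitian := by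
    rw [Matrix.IsHermitian, Matrix.conjTranspose_eq_transpose_of_trivial, Matrix.transpose_smul,
      Matrix.transpose_mul, Matrix.transpose_transpose]
  obtain ⟨hl1, hl2⟩ := lambdaMin_mem_Icc hd hherm hlo' hup'
  have hcherm : (couplingMatrix σ γ X).IsHermitian :=
    Matrix.IsHermitian.sub (by
      rw [Matrix.IsHermitian, Matrix.conjTranspose_eq_transpose_of_trivial, Matrix.transpose_smul,
        Matrix.transpose_one]) hherm
  have hcform : ∀ v : Fin d → ℝ, v ⬝ᵥ (couplingMatrix σ γ X *ᵥ v) =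
      γ * (v ⬝ᵥ v) - v ⬝ᵥ (((σ ^ 2)⁻¹ • (Xᵀ * X)) *ᵥ v) := fun v => by
    rw [couplingMatrix, Matrix.sub_mulVec, dotProduct_sub, Matrix.smul_mulVec (b := γ),
      Matrix.one_mulVec, dotProduct_smul, smul_eq_mul]
  have hlγ : 0 < γ - l := by linarith
  have hinv := inv_form_ge hcherm (sub_pos.2 huγ) hlγ
    (fun v => by rw [hcform]; linarith [hup' v]) (fun v => by rw [hcform]; linarith [hlo' v])
  refine ⟨γ, ?_, ⟨hV, ⟨-M, ?_⟩, ?_⟩, 1 / (γ - l) - M, sub_pos.2 hMγ,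
    fun y => strongConvexOn_hamiltonian hV hM hinv y⟩
  · refine lt_of_le_of_lt ?_ huγ
    have hle : matrixOpNorm X ≤ Real.sqrt (σ ^ 2 * u) := by
      refine ContinuousLinearMap.opNorm_le_bound _ (Real.sqrt_nonneg _) fun v => ?_
      refine abs_le_of_sq_le_sq' ?_ (by positivity) |>.2
      rw [mul_pow, Real.sq_sqrt (by positivity), LinearMap.coe_toContinuousLinearMap', mul_assoc]
      have := hup v
      rwa [inv_mul_le_iff₀ (by positivity)] at this
    have h0 : 0 ≤ matrixOpNorm X := norm_nonneg _
    rw [inv_mul_le_iff₀ (by positivity), ← Real.sq_sqrt (by positivity : 0 ≤ σ ^ 2 * u)]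
    gcongr
  · rintro _ ⟨t, rfl⟩; exact hM t
  · have h1 : 1 / (γ - l) ≤ 1 / (γ - lambdaMin ((σ ^ 2)⁻¹ • (Xᵀ * X))) :=
      one_div_le_one_div_of_le (by linarith) (by linarith)
    have h2 : -M ≤ ⨅ t, iteratedDeriv 2 (potentialV π₀ γ) t := le_ciInf hM
    linarith

/-- The scalar comparison between the curvature of `V_γ` and the spectral gap of `A⁻¹`. Here `s`
stands for `√(d / n)`, `N` for `n / σ²` and `ε` for the relative error of the covariance. -/
theorem curvature_lt_gap {C c₁ c₂ C₁ K s N p ε γ : ℝ} (hC : 0 < C) (hc₁ : 0 < c₁) (hc₂ : 0 < c₂)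
    (hC₁ : 4416 * (C * c₁ * (1 + Real.log (3 / (2 * c₂) + 1))) / c₂ < C₁) (hK : 1 ≤ K)
    (hs : 0 < s) (hN1 : 1 / (c₁ * s ^ 2) < N) (hN2 : N < 1 / (c₂ * s ^ 2)) (hp : 1 ≤ p)
    (hε : ε = 2944 * K ^ 2 * s) (hε1 : ε ≤ 1 / 4) (hγ : γ = N * (1 + 2 * ε))
    (hmain : C₁ * (s ^ 2 + s ^ 4) * (1 + Real.log (1 / s ^ 2 + 1)) ^ p ≤ s / (2 * K ^ 2)) :
    C * (1 + Real.log (γ + 1)) / γ < 1 / (γ - N * (1 - ε)) := by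
  have hε0 : 0 < ε := by rw [hε]; positivity
  have hN0 : 0 < N := lt_trans (by positivity) hN1
  set b := 1 + Real.log (3 / (2 * c₂) + 1) with hb
  have hb1 : 1 ≤ b := by
    have : 0 ≤ Real.log (3 / (2 * c₂) + 1) := Real.log_nonneg (by
      have : 0 < 3 / (2 * c₂) := by positivity
      linarith)
    linarith
  set l := 1 + Real.log (1 / s ^ 2 + 1) with hl
  have hl1 : 1 ≤ l := by
    have : 0 ≤ Real.log (1 / s ^ 2 + 1) := Real.log_nonneg (by
      have : 0 < 1 / s ^ 2 := by positivity
      linarith)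
    linarith
  have hγN : N ≤ γ := by rw [hγ]; nlinarith
  have hγ0 : 0 < γ := hN0.trans_le hγN
  have hγup : γ ≤ 3 / (2 * c₂) * (1 / s ^ 2) := by
    have h1 : γ ≤ N * (3 / 2) := by rw [hγ]; gcongr; linarith
    refine h1.trans ((mul_le_mul_of_nonneg_right hN2.le (by norm_num)).trans (le_of_eq ?_))
    field_simp
  have hlog : 1 + Real.log (γ + 1) ≤ b * l := by
    have h1 : γ + 1 ≤ (3 / (2 * c₂) + 1) * (1 / s ^ 2 + 1) := by
      have : 0 < 3 / (2 * c₂) := by positivity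
      have : 0 < 1 / s ^ 2 := by positivity
      nlinarith
    have h2 := Real.log_le_log (by linarith) h1
    rw [Real.log_mul (by positivity) (by positivity)] at h2
    nlinarith
  have hlp : l ≤ l ^ p := by
    simpa using Real.rpow_le_rpow_of_exponent_le hl1 hp
  have hl0 : 0 < l := by linarith
  have hb0 : 0 < b := by linarith
  have hinvN : 1 / γ ≤ c₁ * s ^ 2 := by
    rw [div_le_iff₀ hγ0]
    rw [div_lt_iff₀ (by positivity)] at hN1
    nlinarith [mul_pos hc₁ (pow_pos hs 2)]
  have hA0 : 0 < C * c₁ * b := by positivity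
  have hC₁0 : 0 < C₁ := lt_trans (by positivity) hC₁
  have hup : C * (1 + Real.log (γ + 1)) / γ ≤ C * c₁ * b * (s ^ 2 * l ^ p) := by
    calc C * (1 + Real.log (γ + 1)) / γ = C * (1 + Real.log (γ + 1)) * (1 / γ) := by ring
      _ ≤ C * (b * l ^ p) * (c₁ * s ^ 2) := by
          gcongr
          exact hlog.trans (by gcongr)
      _ = _ := by ring
  have hmain' : C₁ * (s ^ 2 * l ^ p) ≤ s / (2 * K ^ 2) := by
    refine le_trans ?_ hmain
    rw [mul_assoc]
    gcongr
    have : 0 < s ^ 4 := by positivity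
    linarith
  -- The spread `γ - N(1 - ε)` is `3εN`, and `8832 = 3 · 2944`; half of it, `4416`, matches the 2 in
  -- `s / (2 * K ^ 2)`.
  have hlow : c₂ * s / (8832 * K ^ 2) < 1 / (γ - N * (1 - ε)) := by
    rw [show γ - N * (1 - ε) = 3 * ε * N by rw [hγ]; ring, div_lt_div_iff₀ (by positivity)
      (by positivity), hε]
    rw [lt_div_iff₀ (by positivity)] at hN2
    have : c₂ * s * (3 * (2944 * K ^ 2 * s) * N) = N * (c₂ * s ^ 2) * (8832 * K ^ 2) := by ring
    rw [this]
    gcongr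
  refine lt_of_le_of_lt (hup.trans ?_) hlow
  rw [div_lt_iff₀ hc₂] at hC₁
  have h1 : 4416 * (C * c₁ * b) * (s ^ 2 * l ^ p) ≤ c₂ * (C₁ * (s ^ 2 * l ^ p)) := by
    have : 0 ≤ s ^ 2 * l ^ p := by positivity
    nlinarith
  have h2 : c₂ * (C₁ * (s ^ 2 * l ^ p)) ≤ c₂ * (s / (2 * K ^ 2)) := by gcongr
  have h3 : c₂ * s / (8832 * K ^ 2) = c₂ * (s / (2 * K ^ 2)) / 4416 := by field_simp; norm_num
  rw [h3]
  linarith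

theorem mainTheorem1
    (c₁ c₂ : ℝ) (hc₁ : 0 < c₁) (hc₂ : 0 < c₂)
    (q : ℝ) (hq : q ∈ Set.Icc (0 : ℝ) 1)
    (μ : Measure ℝ) [IsProbabilityMeasure μ] :
    ∃ C₁ : ℝ, 0 < C₁ ∧
      ∀ k : ℕ, 1 ≤ k → IsAdmissibleSlab μ k →
      ∀ n d : ℕ, 1 ≤ n → 1 ≤ d →
      ∀ σ : ℝ, 0 < σ → σ ^ 2 / (d : ℝ) < c₁ → c₂ < σ ^ 2 / (d : ℝ) →
      ∀ (Ω : Type*) [MeasurableSpace Ω] (P : Measure Ω) [IsProbabilityMeasure P]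
        (x : Fin n → Ω → EuclideanSpace ℝ (Fin d)) (K : ℝ),
        (∀ i, Measurable (x i)) →
        iIndepFun x P →
        (∀ i, IsIsotropic P (x i)) →
        (∀ i, psi2NormVec P (x i) ≤ ENNReal.ofReal K) →
        4 * C₁ * K ^ 4 ≤ (n : ℝ) / (d : ℝ) →
        C₁ * ((d : ℝ) / (n : ℝ) + (d : ℝ) ^ 2 / (n : ℝ) ^ 2) *
            (1 + Real.log ((n : ℝ) / (d : ℝ) + 1)) ^ ((2 * (k : ℝ) - 1) / (k : ℝ)) ≤
          Real.sqrt ((d : ℝ) / (n : ℝ)) / (2 * K ^ 2) →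
        ∃ E : Set Ω, MeasurableSet E ∧
          ENNReal.ofReal (1 - 2 * Real.exp (-(d : ℝ))) ≤ P E ∧
          ∀ ω ∈ E, IsFeasible (spikeSlab q μ) σ (Matrix.of fun i j => x i ω j) := by
  -- `C₁` is chosen before `k`. The density found for one `k` serves for every `k`, since the
  -- curvature bound does not involve `k`; with no such `k` there is nothing to prove.
  by_cases hadm : ∃ k, IsAdmissibleSlab μ k
  swap
  · exact ⟨1, one_pos, fun k _ hk => absurd ⟨k, hk⟩ hadm⟩
  obtain ⟨_, f, hμ, hconc, heven, a, ha, b, hb, hf⟩ := hadm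
  have hpos : ∀ x, 0 < f x := fun x => lt_of_lt_of_le (by positivity) (hf x)
  obtain ⟨C, hC, hcurv⟩ := exists_curvature_bound hq μ hpos hconc heven hμ
  have hprob := isProbabilityMeasure_spikeSlab hq μ
  have hlogc : 0 < Real.log (3 / (2 * c₂) + 1) := Real.log_pos (by
    have : 0 < 3 / (2 * c₂) := by positivity
    linarith)
  set D := 4416 * (C * c₁ * (1 + Real.log (3 / (2 * c₂) + 1))) / c₂ with hD
  have hD0 : 0 < D := by positivity
  -- `D` makes the gap beat the curvature, `c₁` ensures `γ ≥ 1`, and `4·10⁷` gives `d ≤ n` and `ε ≤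
  -- 1/4`, because `16 · 2944² ≤ 4 · 4·10⁷`.
  refine ⟨D + c₁ + 40000000, by positivity, ?_⟩
  intro k hk _ n d hn hd σ hσ hσ1 hσ2 Ω _ P _ x K hm hind hiso hpsi hnd hmain
  set C₁ := D + c₁ + 40000000 with hC₁
  obtain ⟨hK, hevent⟩ := exists_event_abs_form_le hn hd hm hind hiso hpsi
  have hn0 : (0 : ℝ) < n := by exact_mod_cast hn
  have hd0 : (0 : ℝ) < d := by exact_mod_cast hd
  have hK4 : 1 ≤ K ^ 4 := one_le_pow₀ hK
  have hr : 4 * C₁ ≤ (n : ℝ) / d := le_trans (by nlinarith) hnd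
  have hdn : d ≤ n := by
    have h1 : 1 ≤ (n : ℝ) / d := by linarith
    rw [one_le_div hd0] at h1
    exact_mod_cast h1
  obtain ⟨E, hE, hPE, hform⟩ := hevent hdn
  refine ⟨E, hE, hPE, fun ω hω => ?_⟩
  set s := Real.sqrt ((d : ℝ) / n) with hs
  have hs0 : 0 < s := Real.sqrt_pos.2 (by positivity)
  have hs2 : s ^ 2 = d / n := Real.sq_sqrt (by positivity)
  have hs2' : 1 / s ^ 2 = n / d := by rw [hs2, one_div_div]
  set ε := 2944 * K ^ 2 * s with hε
  have hε0 : 0 < ε := by positivity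
  have hε1 : ε ≤ 1 / 4 := by
    have h1 : K ^ 4 * s ^ 2 * (4 * C₁) ≤ 1 := by
      rw [hs2]
      calc K ^ 4 * ((d : ℝ) / n) * (4 * C₁) = 4 * C₁ * K ^ 4 * ((d : ℝ) / n) := by ring
        _ ≤ (n : ℝ) / d * ((d : ℝ) / n) := by gcongr
        _ = 1 := by field_simp
    have h2 : K ^ 4 * s ^ 2 * 160000000 ≤ 1 := le_trans (by gcongr; linarith) h1
    have h3 : ε ^ 2 ≤ (1 / 4) ^ 2 := by
      rw [hε, show (2944 * K ^ 2 * s) ^ 2 = 2944 ^ 2 * (K ^ 4 * s ^ 2) by ring]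
      linarith
    exact le_of_sq_le_sq h3 (by norm_num)
  set N := (n : ℝ) / σ ^ 2 with hN
  have hN0 : 0 < N := by positivity
  have hN1 : 1 / (c₁ * s ^ 2) < N := by
    rw [hs2, hN, div_lt_div_iff₀ (by positivity) (by positivity)]
    rw [div_lt_iff₀ hd0] at hσ1
    rw [show (n : ℝ) * (c₁ * (d / n)) = c₁ * d by field_simp]
    linarith
  have hN2 : N < 1 / (c₂ * s ^ 2) := by
    rw [hs2, hN, div_lt_div_iff₀ (by positivity) (by positivity)]
    rw [lt_div_iff₀ hd0] at hσ2
    rw [show (n : ℝ) * (c₂ * (d / n)) = c₂ * d by field_simp]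
    linarith
  -- Strictly above the spectral bound `N(1 + ε)`, yet within `3εN` of the lower bound `N(1 - ε)`.
  set γ := N * (1 + 2 * ε) with hγ
  have hγ1 : 1 ≤ γ := by
    have h1 : 1 ≤ 1 / (c₁ * s ^ 2) := by
      rw [← div_div, div_right_comm, hs2', one_le_div hc₁]
      linarith
    have h2 : N ≤ γ := by rw [hγ]; nlinarith
    linarith
  have hp : 1 ≤ (2 * (k : ℝ) - 1) / k := by
    have hk1 : (1 : ℝ) ≤ k := by exact_mod_cast hk
    rw [one_le_div (by linarith)]
    linarith
  have hgap := curvature_lt_gap (C₁ := C₁) (γ := γ) hC hc₁ hc₂ (by rw [hC₁]; linarith) hK hs0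
    hN1 hN2 hp hε hε1 hγ (by
      rw [hs2', show s ^ 4 = (s ^ 2) ^ 2 by ring, hs2, div_pow]
      exact hmain)
  have hscale : ∀ v : EuclideanSpace ℝ (Fin d),
      (σ ^ 2)⁻¹ * ‖Matrix.toEuclideanLin (Matrix.of fun i j => x i ω j) v‖ ^ 2
        = N * ((n : ℝ)⁻¹ * ‖Matrix.toEuclideanLin (Matrix.of fun i j => x i ω j) v‖ ^ 2) := by
    intro v
    rw [hN]; field_simp
  refine isFeasible_of_form_bounds hd (l := N * (1 - ε)) (u := N * (1 + ε)) (γ := γ)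
    (by positivity) (fun v => ?_) (fun v => ?_) hσ ?_
    (contDiff_potentialV _ (by linarith)) (hcurv γ hγ1) hgap
  · rw [hscale, mul_assoc]
    refine mul_le_mul_of_nonneg_left ?_ hN0.le
    linarith [(abs_le.1 (hform ω hω v)).1]
  · rw [hscale, mul_assoc]
    refine mul_le_mul_of_nonneg_left ?_ hN0.le
    linarith [(abs_le.1 (hform ω hω v)).2]
  · rw [hγ]; gcongr; linarith
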